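/- **Mesh.** Let $\Omega\subset\mathbb{R}^3$ be open and connected, with a polyhedral mesh: finitely many pairwise disjoint open bounded elements $T$ with $\overline\Omega=\bigcup_T\overline T$; finitely many pairwise disjoint, relatively open planar faces $F$, each contained either in $\partial T\cap\partial T'$ for two distinct elements or in $\partial T\cap\partial\Omega$ for an element $T$; finitely many pairwise disjoint edges $E$ (open segments), whose endpoints are the vertices. Edges do not meet faces and vertices meet neither edges nor faces. Elements and faces are simply connected with connected Lipschitz boundaries. For each element $T$, $\partial T$ is the union of the closures of the faces in $\mathcal F_T=\{F: F\subset\partial T\}$, and for each face $F$ the relative boundary $\partial F$ is the union of the closures of the edges in $\mathcal E_F=\{E: E\subset\partial F\}$; every edge belongs to some $\mathcal E_F$. Each $F$ carries a unit normal $n_F$ and each $E$ a unit tangent $t_E$. Let $\omega_{TF}=1$ if $n_F$ points out of $T$ and $-1$ otherwise, and $\omega_{FE}=1$ if $t_E$ is opposite to the counter-clockwise orientation of $\partial F$ with respect to $n_F$ (that is, if $n_F\times t_E$ points out of $F$) and $-1$ otherwise. **Spaces.** $\mathcal P^\ell(X)$ is the space of restrictions to $X$ of polynomials of total degree $\le\ell$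 on $\mathbb R^3$ ($\{0\}$ if $\ell=-1$), $\mathcal P^{0,\ell}(X)$ its zero-average subspace, and $\mathcal P^\ell(F)^2$ the tangential polynomial fields on $F$. On a face, $\mathrm{rot}_F\,q$ is the rotation of the tangential gradient of $q$ by $-\pi/2$ in the plane of $F$ oriented by $n_F$. Set $\mathcal G^\ell(T)=\mathrm{grad}\,\mathcal P^{\ell+1}(T)$, $\mathcal R^\ell(T)=\mathrm{curl}\,\mathcal P^{\ell+1}(T)^3$, $\mathcal R^\ell(F)=\mathrm{rot}_F\,\mathcal P^{\ell+1}(F)$; the exponent $\perp$ denotes the $L^2$-orthogonal complement in $\mathcal P^\ell(T)^3$, resp. $\mathcal P^\ell(F)^2$. Fix $k\ge0$ and an element $T$, and let $\mathcal E_T=\bigcup_{F\in\mathcal F_T}\mathcal E_F$. Then $X_{\mathrm{curl},T}$ consists of the vectors $\zeta=(\zeta_{R,T},\zeta_{R,T}^\perp,(\zeta_{R,F},\zeta_{R,F}^\perp)_{F\in\mathcal F_T},(\zeta_E)_{E\in\mathcal E_T})$ in $\mathcal R^{k-1}(T)\times\mathcal R^k(T)^\perp\times\prod_F(\mathcal R^{k-1}(F)\times\mathcal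 R^k(F)^\perp)\times\prod_E\mathcal P^k(E)$, and $X_{\mathrm{div},T}$ of the vectors $w=(w_{G,T},w_{G,T}^\perp,(w_F)_{F\in\mathcal F_T})$ in $\mathcal G^{k-1}(T)\times\mathcal G^k(T)^\perp\times\prod_F\mathcal P^k(F)$. **Operators.** For $\zeta\in X_{\mathrm{curl},T}$, $F\in\mathcal F_T$ and $w\in X_{\mathrm{div},T}$, define $C_F\zeta\in\mathcal P^k(F)$, $\gamma_F\zeta\in\mathcal P^k(F)^2$, $\dot C_T\zeta\in\mathcal P^k(T)^3$, $D_Tw\in\mathcal P^k(T)$ and $P_{\mathrm{div},T}w\in\mathcal P^k(T)^3$ by - $\int_F C_F\zeta\,q=\int_F\zeta_{R,F}\cdot\mathrm{rot}_F\,q-\sum_{E\in\mathcal E_F}\omega_{FE}\int_E\zeta_E\,q$ for all $q\in\mathcal P^k(F)$; - $\int_F\gamma_F\zeta\cdot(\mathrm{rot}_F\,r+\tau)=\int_F C_F\zeta\,r+\sum_{E\in\mathcal E_F}\omega_{FE}\int_E\zeta_E\,r+\int_F\zeta_{R,F}^\perp\cdot\tau$ for all $r\in\mathcal P^{0,k+1}(F)$,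 $\tau\in\mathcal R^k(F)^\perp$; - $\int_T\dot C_T\zeta\cdot\tau=\int_T\zeta_{R,T}\cdot\mathrm{curl}\,\tau+\sum_{F\in\mathcal F_T}\omega_{TF}\int_F\gamma_F\zeta\cdot(\tau\times n_F)$ for all $\tau\in\mathcal P^k(T)^3$; - $\int_T D_Tw\,q=-\int_T w_{G,T}\cdot\mathrm{grad}\,q+\sum_{F\in\mathcal F_T}\omega_{TF}\int_F w_F\,q$ for all $q\in\mathcal P^k(T)$; - $\int_T P_{\mathrm{div},T}w\cdot(\mathrm{grad}\,q+v)=-\int_T D_Tw\,q+\sum_{F\in\mathcal F_T}\omega_{TF}\int_F w_F\,q+\int_T w_{G,T}^\perp\cdot v$ for all $q\in\mathcal P^{0,k+1}(T)$, $v\in\mathcal G^k(T)^\perp$. Moreover set $C_T\zeta=(\pi_{\mathcal G^{k-1}(T)}\dot C_T\zeta,\ \pi_{\mathcal G^k(T)^\perp}\dot C_T\zeta,\ (C_F\zeta)_{F\in\mathcal F_T})$, where $\pi_S$ is the $L^2(T)$-orthogonal projection on $S$. **Proposition.** All these objects are well defined: the $L^2(T)$-projections of fields of $\mathcal P^k(T)^3$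 on $\mathcal G^{k-1}(T)$ and $\mathcal G^k(T)^\perp$ exist and are unique, each of the five problems has exactly one solution, and $C_T\zeta\in X_{\mathrm{div},T}$. Moreover $$P_{\mathrm{div},T}(C_T\zeta)=\dot C_T\zeta\qquad\text{for all }\zeta\in X_{\mathrm{curl},T}.$$ -/

import Mathlib

open MeasureTheory
open scoped RealInnerProductSpace NNReal

namespace DDR

noncomputable section

/-! ### Euclidean space, polynomials, vector operators -/

/-- The Euclidean space `ℝ³`. -/
abbrev E3 : Type := EuclideanSpace ℝ (Fin 3)

/-- The cross product of `ℝ³`. -/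
def cross (a b : E3) : E3 := WithLp.toLp 2 (crossProduct a.ofLp b.ofLp)

/-- Polynomials in three variables. -/
abbrev Poly3 : Type := MvPolynomial (Fin 3) ℝ

/-- `ℙ₃^ℓ`: polynomials in three variables of total degree at most `ℓ`; it is `{0}` for `ℓ < 0`. -/
def polyLE (ℓ : ℤ) : Submodule ℝ Poly3 :=
  if 0 ≤ ℓ then MvPolynomial.restrictTotalDegree (Fin 3) ℝ ℓ.toNat else ⊥

/-- The value of a polynomial at a point. -/
def ev (p : Poly3) (x : E3) : ℝ := MvPolynomial.eval (fun i => x i) p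

/-- The value of a vector of polynomials at a point. -/
def vev (v : Fin 3 → Poly3) (x : E3) : E3 := WithLp.toLp 2 (fun i => ev (v i) x)

/-- The gradient of a polynomial. -/
def grad (p : Poly3) : Fin 3 → Poly3 := fun i => MvPolynomial.pderiv i p

/-- The curl of a vector of polynomials. -/
def curl (v : Fin 3 → Poly3) : Fin 3 → Poly3 :=
  ![MvPolynomial.pderiv 1 (v 2) - MvPolynomial.pderiv 2 (v 1),
    MvPolynomial.pderiv 2 (v 0) - MvPolynomial.pderiv 0 (v 2),
    MvPolynomial.pderiv 0 (v 1) - MvPolynomial.pderiv 1 (v 0)]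

/-- The tangential gradient `GRAD_F p` on a plane with unit normal `n`: the orthogonal projection of
the gradient on the plane. It depends on the restriction of `p` to the plane only. -/
def gradF (n : E3) (p : Poly3) (x : E3) : E3 := vev (grad p) x - ⟪vev (grad p) x, n⟫ • n

/-- The rotation of angle `-π/2` in the tangent plane orthogonal to, and oriented by, the unit
vector `n` (the rotation of angle `π/2` being `v ↦ n × v`). -/
def rotNeg (n v : E3) : E3 := cross v n

/-- The two-dimensional vector curl on a face: the rotation of angle `-π/2` of the tangential
gradient. -/
def vrotF (n : E3) (p : Poly3) (x : E3) : E3 := rotNeg n (gradF n p x)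

/-! ### Spaces of polynomial functions on a subset `X` of `ℝ³`

Functions on `X` are functions on the subtype of `X`. Integration over a `d`-dimensional `X` is with
respect to the `d`-dimensional Hausdorff measure, normalised to agree with the Lebesgue measure:
`μHE[3]` is the Lebesgue measure on an open set, `μHE[2]` the area on a planar face, and
`μHE[1]` the length on a segment. -/

/-- `P^ℓ(X)`: restrictions to `X` of polynomials of degree at most `ℓ`. -/
def polyOn (X : Set E3) (ℓ : ℤ) : Set (X → ℝ) :=
  {f | ∃ p ∈ polyLE ℓ, ∀ x : X, f x = ev p x}

/-- `P^ℓ(X)³`. -/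
def vecPolyOn (X : Set E3) (ℓ : ℤ) : Set (X → E3) :=
  {v | ∀ i : Fin 3, (fun x : X => v x i) ∈ polyOn X ℓ}

/-- `P^ℓ(F)²` for a subset `F` of a plane with unit normal `n`: the tangential fields with polynomial
components. -/
def tanPolyOn (n : E3) (F : Set E3) (ℓ : ℤ) : Set (F → E3) :=
  {v | v ∈ vecPolyOn F ℓ ∧ ∀ x : F, ⟪v x, n⟫ = 0}

/-- The `L²`-product of vector fields on the `d`-dimensional set `X`. -/
def ip (d : ℕ) {X : Set E3} (u v : X → E3) : ℝ := ∫ x : X, ⟪u x, v x⟫ ∂μHE[d]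

/-- The `L²`-orthogonal complement of `S` in `A`, on the `d`-dimensional set `X`. -/
def orthIn (d : ℕ) {X : Set E3} (A S : Set (X → E3)) : Set (X → E3) :=
  {v | v ∈ A ∧ ∀ w ∈ S, ip d v w = 0}

/-- `G^ℓ(T) = GRAD P^{ℓ+1}(T)`. -/
def golyT (T : Set E3) (ℓ : ℤ) : Set (T → E3) :=
  {v | ∃ p ∈ polyLE (ℓ + 1), ∀ x : T, v x = vev (grad p) x}

/-- `G^ℓ(T)^⊥`, in `P^ℓ(T)³`. -/
def golyPerpT (T : Set E3) (ℓ : ℤ) : Set (T → E3) := orthIn 3 (vecPolyOn T ℓ) (golyT T ℓ)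

/-- `R^ℓ(T) = CURL P^{ℓ+1}(T)³`. -/
def rolyT (T : Set E3) (ℓ : ℤ) : Set (T → E3) :=
  {v | ∃ w : Fin 3 → Poly3, (∀ i, w i ∈ polyLE (ℓ + 1)) ∧ ∀ x : T, v x = vev (curl w) x}

/-- `R^ℓ(T)^⊥`, in `P^ℓ(T)³`. -/
def rolyPerpT (T : Set E3) (ℓ : ℤ) : Set (T → E3) := orthIn 3 (vecPolyOn T ℓ) (rolyT T ℓ)

/-- `R^ℓ(F) = VROT_F P^{ℓ+1}(F)` for a face `F` with unit normal `n`. -/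
def rolyF (n : E3) (F : Set E3) (ℓ : ℤ) : Set (F → E3) :=
  {v | ∃ p ∈ polyLE (ℓ + 1), ∀ x : F, v x = vrotF n p x}

/-- `R^ℓ(F)^⊥`, in `P^ℓ(F)²`. -/
def rolyPerpF (n : E3) (F : Set E3) (ℓ : ℤ) : Set (F → E3) :=
  orthIn 2 (tanPolyOn n F ℓ) (rolyF n F ℓ)

/-- `g` is the `L²`-orthogonal projection on the space `S` of the field `v` on the
three-dimensional `T`. -/
def IsProj {T : Set E3} (S : Set (T → E3)) (v g : T → E3) : Prop :=
  g ∈ S ∧ ∀ w ∈ S, ip 3 g w = ip 3 v w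

/-- The `L²`-orthogonal projection on the space `S`. -/
def proj {T : Set E3} (S : Set (T → E3)) (v : T → E3) : T → E3 :=
  Classical.epsilon fun g => IsProj S v g

/-! ### Polyhedral meshes -/

/-- The plane with normal `n` and offset `c`. -/
def plane (n : E3) (c : ℝ) : Set E3 := {x | ⟪n, x⟫ = c}

/-- The relatively open subset `S` of the affine subspace `P` has a Lipschitz boundary: near each
point of its relative boundary it is the strict epigraph, in some direction `e` of `P`, of a Lipschitz
function of the component orthogonal to `e`. -/
def HasLipschitzBoundary (P S : Set E3) : Prop :=
  ∀ x ∈ closure S \ S, ∃ e : E3, ‖e‖ = 1 ∧ (∀ y ∈ P, ∀ s : ℝ, y + s • e ∈ P) ∧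
    ∃ (K : ℝ≥0) (φ : E3 → ℝ) (r : ℝ), LipschitzWith K φ ∧ 0 < r ∧
      ∀ y ∈ P, dist y x < r → (y ∈ S ↔ φ (y - ⟪e, y⟫ • e) < ⟪e, y⟫)

/-- The direction `ν` points out of `S` at all points of `Y` (a part of the boundary of `S`). -/
def PointsOut (S Y : Set E3) (ν : E3) : Prop :=
  ∀ x ∈ Y, ∃ ε : ℝ, 0 < ε ∧ ∀ t : ℝ, 0 < t → t < ε → x - t • ν ∈ S ∧ x + t • ν ∉ S

/-- A polyhedral mesh of the domain `Ω`, with orientations of its faces and edges.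
Elements, faces and edges are relatively open; the index types are finite. -/
structure PolyMesh (Ω : Set E3) where
  /-- Indices of elements, faces, edges and vertices. -/
  Elem : Type
  Face : Type
  Edge : Type
  Vert : Type
  finite_elem : Finite Elem
  finite_face : Finite Face
  finite_edge : Finite Edge
  finite_vert : Finite Vert
  /-- The corresponding subsets (points) of `ℝ³`. -/
  elem : Elem → Set E3
  face : Face → Set E3
  edge : Edge → Set E3
  vert : Vert → E3
  /-- The elements partition the domain. -/
  isOpen_domain : IsOpen Ω
  isConnected_domain : IsConnected Ω
  elem_subset : ∀ T, elem T ⊆ Ω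
  closure_domain : closure Ω = ⋃ T, closure (elem T)
  elem_disjoint : ∀ T T', T ≠ T' → Disjoint (elem T) (elem T')
  /-- Elements are open bounded simply connected sets with connected Lipschitz boundary. -/
  elem_isOpen : ∀ T, IsOpen (elem T)
  elem_isBounded : ∀ T, Bornology.IsBounded (elem T)
  elem_simplyConnected : ∀ T, IsSimplyConnected (elem T)
  elem_boundary_connected : ∀ T, IsConnected (frontier (elem T))
  elem_lipschitz : ∀ T, HasLipschitzBoundary Set.univ (elem T)
  /-- The boundary of an element is made of (closed) faces. -/
  elem_frontier : ∀ T, frontier (elem T) =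
    ⋃ F ∈ {F | face F ⊆ frontier (elem T)}, closure (face F)
  /-- The unit normal vector orienting a face, and the plane containing the face. -/
  normal : Face → E3
  offset : Face → ℝ
  norm_normal : ∀ F, ‖normal F‖ = 1
  /-- Faces are planar, relatively open, simply connected, with connected Lipschitz boundary. -/
  face_isOpen : ∀ F, ∃ U : Set E3, IsOpen U ∧ face F = U ∩ plane (normal F) (offset F)
  face_simplyConnected : ∀ F, IsSimplyConnected (face F)
  face_boundary_connected : ∀ F, IsConnected (closure (face F) \ face F)
  face_lipschitz : ∀ F, HasLipschitzBoundary (plane (normal F) (offset F)) (face F)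
  face_disjoint : ∀ F F', F ≠ F' → Disjoint (face F) (face F')
  /-- A face is either an interface or a boundary face. -/
  face_interface_or_boundary : ∀ F,
    (∃ T T', T ≠ T' ∧ face F ⊆ frontier (elem T) ∩ frontier (elem T')) ∨
    (∃ T, face F ⊆ frontier (elem T) ∩ frontier Ω)
  /-- The boundary of a face is made of (closed) edges. -/
  face_boundary : ∀ F, closure (face F) \ face F =
    ⋃ E ∈ {E | edge E ⊆ closure (face F) \ face F}, closure (edge E)
  /-- Edges are open segments, oriented from the vertex `src` to the vertex `tgt`. -/
  src : Edge → Vert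
  tgt : Edge → Vert
  src_ne_tgt : ∀ E, src E ≠ tgt E
  edge_eq : ∀ E, edge E = openSegment ℝ (vert (src E)) (vert (tgt E))
  /-- Edges are edges of faces, and vertices are endpoints of edges. -/
  edge_of_face : ∀ E, ∃ F, edge E ⊆ closure (face F) \ face F
  vert_of_edge : ∀ V, ∃ E, src E = V ∨ tgt E = V
  /-- Distinct faces, edges and vertices do not meet. -/
  vert_injective : Function.Injective vert
  edge_disjoint : ∀ E E', E ≠ E' → Disjoint (edge E) (edge E')
  edge_face_disjoint : ∀ E F, Disjoint (edge E) (face F)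
  vert_notMem_edge : ∀ V E, vert V ∉ edge E
  vert_notMem_face : ∀ V F, vert V ∉ face F

namespace PolyMesh

variable {Ω : Set E3} (M : PolyMesh Ω)

instance : Finite M.Elem := M.finite_elem
instance : Finite M.Face := M.finite_face
instance : Finite M.Edge := M.finite_edge
instance : Finite M.Vert := M.finite_vert

/-- `F_T`: the faces contained in the boundary of the element `T`. -/
def FaceOf (T : M.Elem) : Type := {F : M.Face // M.face F ⊆ frontier (M.elem T)}

/-- `E_F`: the edges contained in the boundary of the face `F`. -/
def EdgeOf (F : M.Face) : Type := {E : M.Edge // M.edge E ⊆ closure (M.face F) \ M.face F}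

/-- `E_T`: the edges of the faces of the element `T`. -/
def EdgeOfElem (T : M.Elem) : Type :=
  {E : M.Edge // ∃ F : M.FaceOf T, M.edge E ⊆ closure (M.face F.1) \ M.face F.1}

instance (T : M.Elem) : Fintype (M.FaceOf T) :=
  @Fintype.ofFinite _ (inferInstanceAs (Finite {F : M.Face // M.face F ⊆ frontier (M.elem T)}))

instance (F : M.Face) : Fintype (M.EdgeOf F) :=
  @Fintype.ofFinite _
    (inferInstanceAs (Finite {E : M.Edge // M.edge E ⊆ closure (M.face F) \ M.face F}))

/-- The unit tangent vector `t_E`. -/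
def tangent (E : M.Edge) : E3 :=
  (‖M.vert (M.tgt E) - M.vert (M.src E)‖)⁻¹ • (M.vert (M.tgt E) - M.vert (M.src E))

/-- `n_FE`: the unit vector normal to `E` in the plane of `F` such that `(t_E, n_FE, n_F)` is
right-handed. -/
def normalFE (F : M.Face) (E : M.Edge) : E3 := cross (M.normal F) (M.tangent E)

open Classical in
/-- `ω_TF`: `1` if `n_F` points out of `T`, `-1` otherwise. -/
def omegaTF (T : M.Elem) (F : M.Face) : ℝ :=
  if PointsOut (M.elem T) (M.face F) (M.normal F) then 1 else -1

open Classical in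
/-- `ω_FE`: `1` if `t_E` is opposite to the counter-clockwise orientation (with respect to `n_F`)
of the boundary of `F`, `-1` otherwise. As the counter-clockwise orientation keeps `F` on the left,
`t_E` is opposite to it when its left normal `n_F × t_E = n_FE` points out of `F`. -/
def omegaFE (F : M.Face) (E : M.Edge) : ℝ :=
  if PointsOut (M.face F) (M.edge E) (M.normalFE F E) then 1 else -1

/-! ### Discrete spaces -/

/-- Vectors of functions on a face and its edges. -/
structure CurlVecF (F : M.Face) where
  vR : M.face F → E3
  vRperp : M.face F → E3
  vE : ∀ E : M.EdgeOf F, M.edge E.1 → ℝ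

/-- Vectors of functions on an element, its faces and its edges. -/
structure CurlVec (T : M.Elem) where
  vR : M.elem T → E3
  vRperp : M.elem T → E3
  fR : ∀ F : M.FaceOf T, M.face F.1 → E3
  fRperp : ∀ F : M.FaceOf T, M.face F.1 → E3
  vE : ∀ E : M.EdgeOfElem T, M.edge E.1 → ℝ

/-- The restriction to a face of `T`. -/
def CurlVec.toFace {M : PolyMesh Ω} {T : M.Elem} (υ : M.CurlVec T) (F : M.FaceOf T) :
    M.CurlVecF F.1 where
  vR := υ.fR F
  vRperp := υ.fRperp F
  vE := fun E => υ.vE ⟨E.1, F, E.2⟩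

/-- The discrete space `X_curl,T^k`. -/
def Xcurl (k : ℕ) (T : M.Elem) : Set (M.CurlVec T) :=
  {υ | υ.vR ∈ rolyT (M.elem T) (k - 1) ∧ υ.vRperp ∈ rolyPerpT (M.elem T) k ∧
    (∀ F : M.FaceOf T, υ.fR F ∈ rolyF (M.normal F.1) (M.face F.1) (k - 1) ∧
      υ.fRperp F ∈ rolyPerpF (M.normal F.1) (M.face F.1) k) ∧
    ∀ E : M.EdgeOfElem T, υ.vE E ∈ polyOn (M.edge E.1) k}

/-- Vectors of functions on an element and its faces. -/
structure DivVec (T : M.Elem) where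
  wG : M.elem T → E3
  wGperp : M.elem T → E3
  wF : ∀ F : M.FaceOf T, M.face F.1 → ℝ

/-- The discrete space `X_div,T^k`. -/
def Xdiv (k : ℕ) (T : M.Elem) : Set (M.DivVec T) :=
  {w | w.wG ∈ golyT (M.elem T) (k - 1) ∧ w.wGperp ∈ golyPerpT (M.elem T) k ∧
    ∀ F : M.FaceOf T, w.wF F ∈ polyOn (M.face F.1) k}

/-! ### Discrete operators

Each operator is defined by a variational problem, stated as a predicate; test functions on an
element, on a face and on its edges are restrictions of polynomials in three variables. -/

/-- `c` solves the problem defining the face curl `C_F^k υ`. -/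
def IsFaceCurl (k : ℕ) (F : M.Face) (υ : M.CurlVecF F) (c : M.face F → ℝ) : Prop :=
  c ∈ polyOn (M.face F) k ∧ ∀ q ∈ polyLE k,
    ∫ x : M.face F, c x * ev q x ∂μHE[2] =
      ip 2 υ.vR (fun x : M.face F => vrotF (M.normal F) q x)
      - ∑ E : M.EdgeOf F, M.omegaFE F E.1 * ∫ x : M.edge E.1, υ.vE E x * ev q x ∂μHE[1]

/-- The discrete face curl `C_F^k`. -/
def faceCurl (k : ℕ) (F : M.Face) (υ : M.CurlVecF F) : M.face F → ℝ :=
  Classical.epsilon fun c => M.IsFaceCurl k F υ c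

/-- `γ` solves the problem defining the tangential face potential `γ_{t,F}^k υ`. -/
def IsFacePotential (k : ℕ) (F : M.Face) (υ : M.CurlVecF F) (γ : M.face F → E3) : Prop :=
  γ ∈ tanPolyOn (M.normal F) (M.face F) k ∧
  ∀ r ∈ polyLE (k + 1), ∫ x : M.face F, ev r x ∂μHE[2] = 0 →
  ∀ τ ∈ rolyPerpF (M.normal F) (M.face F) k,
    ip 2 γ (fun x : M.face F => vrotF (M.normal F) r x + τ x) =
      (∫ x : M.face F, M.faceCurl k F υ x * ev r x ∂μHE[2])
      + (∑ E : M.EdgeOf F, M.omegaFE F E.1 * ∫ x : M.edge E.1, υ.vE E x * ev r x ∂μHE[1])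
      + ip 2 υ.vRperp τ

/-- The discrete tangential face potential `γ_{t,F}^k`. -/
def facePotential (k : ℕ) (F : M.Face) (υ : M.CurlVecF F) : M.face F → E3 :=
  Classical.epsilon fun γ => M.IsFacePotential k F υ γ

/-- `c` solves the problem defining the full element curl of `υ`. -/
def IsElemCurl (k : ℕ) (T : M.Elem) (υ : M.CurlVec T) (c : M.elem T → E3) : Prop :=
  c ∈ vecPolyOn (M.elem T) k ∧ ∀ τ : Fin 3 → Poly3, (∀ i, τ i ∈ polyLE k) →
    ip 3 c (fun x : M.elem T => vev τ x) =
      ip 3 υ.vR (fun x : M.elem T => vev (curl τ) x)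
      + ∑ F : M.FaceOf T, M.omegaTF T F.1 *
          ip 2 (M.facePotential k F.1 (υ.toFace F))
            (fun x : M.face F.1 => cross (vev τ x) (M.normal F.1))

/-- The full element curl. -/
def elemCurl (k : ℕ) (T : M.Elem) (υ : M.CurlVec T) : M.elem T → E3 :=
  Classical.epsilon fun c => M.IsElemCurl k T υ c

/-- The local discrete curl `C_T^k : X_curl,T^k → X_div,T^k`. -/
def discreteCurl (k : ℕ) (T : M.Elem) (υ : M.CurlVec T) : M.DivVec T where
  wG := proj (golyT (M.elem T) (k - 1)) (M.elemCurl k T υ)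
  wGperp := proj (golyPerpT (M.elem T) k) (M.elemCurl k T υ)
  wF := fun F => M.faceCurl k F.1 (υ.toFace F)

/-- `d` solves the problem defining the discrete divergence `D_T^k w`. -/
def IsDiscreteDiv (k : ℕ) (T : M.Elem) (w : M.DivVec T) (d : M.elem T → ℝ) : Prop :=
  d ∈ polyOn (M.elem T) k ∧ ∀ q ∈ polyLE k,
    ∫ x : M.elem T, d x * ev q x ∂μHE[3] =
      - ip 3 w.wG (fun x : M.elem T => vev (grad q) x)
      + ∑ F : M.FaceOf T, M.omegaTF T F.1 * ∫ x : M.face F.1, w.wF F x * ev q x ∂μHE[2]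

/-- The discrete divergence `D_T^k`. -/
def discreteDiv (k : ℕ) (T : M.Elem) (w : M.DivVec T) : M.elem T → ℝ :=
  Classical.epsilon fun d => M.IsDiscreteDiv k T w d

/-- `P` solves the problem defining the vector potential reconstruction `P_div,T^k w`. -/
def IsDivPotential (k : ℕ) (T : M.Elem) (w : M.DivVec T) (P : M.elem T → E3) : Prop :=
  P ∈ vecPolyOn (M.elem T) k ∧
  ∀ q ∈ polyLE (k + 1), ∫ x : M.elem T, ev q x ∂μHE[3] = 0 →
  ∀ v ∈ golyPerpT (M.elem T) k,
    ip 3 P (fun x : M.elem T => vev (grad q) x + v x) =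
      - (∫ x : M.elem T, M.discreteDiv k T w x * ev q x ∂μHE[3])
      + (∑ F : M.FaceOf T, M.omegaTF T F.1 * ∫ x : M.face F.1, w.wF F x * ev q x ∂μHE[2])
      + ip 3 w.wGperp v

/-- The vector potential reconstruction `P_div,T^k`. -/
def divPotential (k : ℕ) (T : M.Elem) (w : M.DivVec T) : M.elem T → E3 :=
  Classical.epsilon fun P => M.IsDivPotential k T w P

end PolyMesh

end

end DDR

/-! Both sides lie in $\mathcal P^k(T)^3$, and the problem defining $P_{\mathrm{div},T}$ has one
solution, so it suffices that $\dot C_T\zeta$ solves it for $w=C_T\zeta$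
(`divPotential_discreteCurl`). Against $v\in\mathcal G^k(T)^\perp$ this is the definition of the
projection. Against gradients the point is that, for every $q\in\mathcal P^{k+1}(T)$, $\int_T\dot
C_T\zeta\cdot\mathrm{grad}\,q=\sum_F\omega_{TF}\int_F C_F\zeta\,q$ (`ip_elemCurl_grad`). Indeed,
testing $\dot C_T\zeta$ with $\mathrm{grad}\,q$ kills the volume term, since curl grad is zero, and
$\mathrm{grad}\,q\times n_F=\mathrm{rot}_F\,q$ turns each face term into the right-hand side
defining $\gamma_F\zeta$: a face integral of $C_F\zeta\,q$ plus edge integrals. The edge integrals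
cancel over the faces of $T$. For $q\in\mathcal P^k(T)$ the same identity gives $D_T(C_T\zeta)=0$
(`discreteDiv_discreteCurl`), so the volume term in the problem for $P_{\mathrm{div},T}$ vanishes
too.

The geometric content is the cancellation: for each edge $E$ the sum of $\omega_{TF}\omega_{FE}$
over the faces of $T$ bordered by $E$ is zero (`sum_omega_mul_omega_eq_zero`). Run once around a
small circle centred at a point of $E$, in the plane orthogonal to $E$. The sum of the indicators of
$T$ and of its closure is locally constant off the faces and jumps by $2\omega_{TF}\omega_{FE}$
across $F$; the jumps of a periodic function add up to zero (`sum_jumps_eq_zero`). That $T$ lies on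
exactly one side of each face, and each face on one side of its edges, with signs given by the
orientations, follows from the Lipschitz boundaries and connectedness (`exists_oneSidedOn`,
`exists_oneSidedOn_pointsOut`).

Well-posedness is Riesz representation in a finite-dimensional space of bounded continuous fields
(`existsUnique_riesz`). Test functions are polynomials on the whole space, so each right-hand side
must be shown to vanish when the test field vanishes on the set. For the two potentials this uses
that a polynomial with zero gradient on $T$, or zero rotor on $F$, is constant there, and that the
right-hand side vanishes on constants by the very definition of $C_F$ or $D_T$. The latter also
makes the zero-average restriction on test functions harmless. -/

namespace DDR

/-! ### The Euclidean Hausdorff measure on flat sets -/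

section Measures

variable {V : Type*} [NormedAddCommGroup V] [InnerProductSpace ℝ V] [FiniteDimensional ℝ V]
  [MeasurableSpace V] [BorelSpace V]

/-- Isometries preserve the Hausdorff measure, which in its Euclidean normalisation is Lebesgue
measure on a $d$-dimensional inner product space. Finiteness on bounded sets and positivity on open
sets are thereby pulled back from planes and lines in $\mathbb R^3$ to Lebesgue measure. -/
theorem euclideanHausdorffMeasure_image_isometry {d : ℕ} (hd : Module.finrank ℝ V = d)
    {f : V → E3} (hf : Isometry f) (s : Set V) :
    (μHE[d] : Measure E3) (f '' s) = volume s := by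
  subst hd
  rw [hf.euclideanHausdorffMeasure_image, InnerProductSpace.euclideanHausdorffMeasure_eq_volume]

theorem isFiniteMeasure_euclideanHausdorffMeasure {d : ℕ} (hd : Module.finrank ℝ V = d)
    {f : V → E3} (hf : Isometry f) {X : Set E3} (hX : Bornology.IsBounded X)
    (hXf : X ⊆ Set.range f) : IsFiniteMeasure (μHE[d] : Measure X) := by
  refine ⟨?_⟩
  have h1 := (isometry_subtype_coe (s := X)).euclideanHausdorffMeasure_image (d := d) Set.univ
  rw [← h1, Set.image_univ, Subtype.range_coe]
  have h2 : X = f '' (f ⁻¹' X) := by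
    rw [Set.image_preimage_eq_inter_range, Set.inter_eq_left.2 hXf]
  rw [h2, euclideanHausdorffMeasure_image_isometry hd hf]
  exact (hf.antilipschitz.isBounded_preimage hX).measure_lt_top

theorem isOpenPosMeasure_euclideanHausdorffMeasure {d : ℕ} (hd : Module.finrank ℝ V = d)
    {f : V → E3} (hf : Isometry f) {X O : Set E3} (hO : IsOpen O)
    (hXf : X = O ∩ Set.range f) : (μHE[d] : Measure X).IsOpenPosMeasure := by
  refine ⟨fun U hU hne => ?_⟩
  obtain ⟨U', hU', rfl⟩ := hU
  obtain ⟨⟨x, hx⟩, hxU⟩ := hne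
  rw [← (isometry_subtype_coe (s := X)).euclideanHausdorffMeasure_image (d := d)]
  have h2 : ((↑) : X → E3) '' ((↑) ⁻¹' U') = f '' (f ⁻¹' (U' ∩ O)) := by
    rw [Set.image_preimage_eq_inter_range, Set.image_preimage_eq_inter_range, Subtype.range_coe,
      Set.inter_assoc, ← hXf]
  rw [h2, euclideanHausdorffMeasure_image_isometry hd hf]
  refine (((hU'.inter hO).preimage hf.continuous).measure_pos _ ?_).ne'
  have hx' := hx
  rw [hXf] at hx'
  obtain ⟨hxO, v, rfl⟩ := hx'
  exact ⟨v, hxU, hxO⟩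

end Measures

theorem exists_isometry_range_eq_plane {n : E3} (hn : ‖n‖ = 1) (c : ℝ) :
    Module.finrank ℝ (ℝ ∙ n)ᗮ = 2 ∧ ∃ f : (ℝ ∙ n)ᗮ → E3, Isometry f ∧ Set.range f = plane n c := by
  have hn0 : n ≠ 0 := by rintro rfl; simp at hn
  refine ⟨?_, fun v => c • n + (v : E3), ?_, ?_⟩
  · have : Fact (Module.finrank ℝ E3 = 2 + 1) := ⟨by simp⟩
    exact Submodule.finrank_orthogonal_span_singleton hn0
  · exact (isometry_add_left (c • n)).comp isometry_subtype_coe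
  · ext x
    simp only [Set.mem_range, plane, Set.mem_ofPred_eq]
    constructor
    · rintro ⟨v, rfl⟩
      have := Submodule.mem_orthogonal_singleton_iff_inner_right.1 v.2
      simp [inner_add_right, inner_smul_right, this, hn]
    · intro h
      refine ⟨⟨x - c • n, ?_⟩, by simp⟩
      rw [Submodule.mem_orthogonal_singleton_iff_inner_right]
      simp [inner_sub_right, inner_smul_right, hn, h]

theorem isometry_line (a : E3) {t : E3} (ht : ‖t‖ = 1) : Isometry fun s : ℝ => a + s • t := by
  refine Isometry.of_dist_eq fun x y => ?_
  simp [dist_eq_norm, ← sub_smul, norm_smul, ht]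

theorem isFiniteMeasure_plane {n : E3} (hn : ‖n‖ = 1) {c : ℝ} {X : Set E3}
    (hX : Bornology.IsBounded X) (h : X ⊆ plane n c) : IsFiniteMeasure (μHE[2] : Measure X) := by
  obtain ⟨hd, f, hf, hr⟩ := exists_isometry_range_eq_plane hn c
  exact isFiniteMeasure_euclideanHausdorffMeasure hd hf hX (hr ▸ h)

theorem isOpenPosMeasure_plane {n : E3} (hn : ‖n‖ = 1) {c : ℝ} {X O : Set E3}
    (hO : IsOpen O) (h : X = O ∩ plane n c) : (μHE[2] : Measure X).IsOpenPosMeasure := by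
  obtain ⟨hd, f, hf, hr⟩ := exists_isometry_range_eq_plane hn c
  exact isOpenPosMeasure_euclideanHausdorffMeasure hd hf hO (hr ▸ h)

theorem isFiniteMeasure_space {X : Set E3} (hX : Bornology.IsBounded X) :
    IsFiniteMeasure (μHE[3] : Measure X) :=
  isFiniteMeasure_euclideanHausdorffMeasure (by simp) isometry_id hX (by simp)

theorem isOpenPosMeasure_space {X : Set E3} (hX : IsOpen X) :
    (μHE[3] : Measure X).IsOpenPosMeasure :=
  isOpenPosMeasure_euclideanHausdorffMeasure (by simp) isometry_id hX (by simp)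

theorem isFiniteMeasure_openSegment {a b : E3} (hab : a ≠ b) :
    IsFiniteMeasure (μHE[1] : Measure (openSegment ℝ a b)) := by
  have h0 : ‖b - a‖ ≠ 0 := by simpa [sub_eq_zero] using hab.symm
  refine isFiniteMeasure_euclideanHausdorffMeasure (V := ℝ) (by simp)
    (isometry_line a (t := ‖b - a‖⁻¹ • (b - a)) (by rw [norm_smul]; simp [h0]))
    (Bornology.IsBounded.subset ?_ (openSegment_subset_segment ℝ a b)) ?_
  · rw [segment_eq_image ℝ a b]
    exact (isCompact_Icc.image (by fun_prop)).isBounded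
  rw [openSegment_eq_image']
  rintro _ ⟨θ, -, rfl⟩
  exact ⟨θ * ‖b - a‖, by simp [smul_smul, h0]⟩

end DDR

namespace DDR

noncomputable section

/-! ### Bounded continuous fields and the Riesz representation of functionals -/

section Riesz

variable {X : Type*} [TopologicalSpace X] {G : Type*} [NormedAddCommGroup G]
  [InnerProductSpace ℝ G]

/-- The bounded continuous functions from `X` to `G`, as a subspace of all functions. -/
def bddCont (X : Type*) [TopologicalSpace X] (G : Type*) [NormedAddCommGroup G]
    [InnerProductSpace ℝ G] : Submodule ℝ (X → G) where
  carrier := {f | Continuous f ∧ ∃ C : ℝ, ∀ x, ‖f x‖ ≤ C}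
  zero_mem' := ⟨continuous_zero, 0, fun x => by simp⟩
  add_mem' := by
    rintro f g ⟨hf, C, hC⟩ ⟨hg, D, hD⟩
    exact ⟨hf.add hg, C + D, fun x => (norm_add_le _ _).trans (add_le_add (hC x) (hD x))⟩
  smul_mem' := by
    rintro c f ⟨hf, C, hC⟩
    refine ⟨hf.const_smul c, ‖c‖ * C, fun x => ?_⟩
    rw [Pi.smul_apply, norm_smul]
    exact mul_le_mul_of_nonneg_left (hC x) (norm_nonneg c)

variable [MeasurableSpace X] [BorelSpace X]

theorem integrable_inner (μ : Measure X) [IsFiniteMeasure μ] {f g : X → G}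
    (hf : f ∈ bddCont X G) (hg : g ∈ bddCont X G) : Integrable (fun x => ⟪f x, g x⟫) μ := by
  obtain ⟨hf, C, hC⟩ := hf
  obtain ⟨hg, D, hD⟩ := hg
  refine Integrable.of_bound (hf.inner hg).aestronglyMeasurable (C * D) (.of_forall fun x => ?_)
  exact (norm_inner_le_norm _ _).trans
    (mul_le_mul (hC x) (hD x) (norm_nonneg _) ((norm_nonneg _).trans (hC x)))

/-- The functional `w ↦ ∫ f · e(w)`. -/
def pairing (μ : Measure X) [IsFiniteMeasure μ] {W : Type*} [AddCommGroup W] [Module ℝ W]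
    {f : X → G} (hf : f ∈ bddCont X G) (e : W →ₗ[ℝ] X → G) (he : ∀ w, e w ∈ bddCont X G) :
    W →ₗ[ℝ] ℝ where
  toFun w := ∫ x, ⟪f x, e w x⟫ ∂μ
  map_add' w w' := by
    rw [← integral_add (integrable_inner μ hf (he w)) (integrable_inner μ hf (he w'))]
    simp [inner_add_right]
  map_smul' c w := by
    rw [RingHom.id_apply, smul_eq_mul, ← integral_const_mul]
    simp [inner_smul_right]

@[simp]
theorem pairing_apply (μ : Measure X) [IsFiniteMeasure μ] {W : Type*} [AddCommGroup W] [Module ℝ W]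
    {f : X → G} (hf : f ∈ bddCont X G) (e : W →ₗ[ℝ] X → G) (he : ∀ w, e w ∈ bddCont X G) (w : W) :
    pairing μ hf e he w = ∫ x, ⟪f x, e w x⟫ ∂μ := rfl

/-- Continuity together with positivity of the measure on open sets upgrades almost-everywhere
vanishing to vanishing. This is what makes the $L^2$-pairing definite on actual functions, without
passing to classes. -/
theorem eq_zero_of_integral_inner_self (μ : Measure X) [IsFiniteMeasure μ] [μ.IsOpenPosMeasure]
    {f : X → G} (hf : f ∈ bddCont X G) (h : ∫ x, ⟪f x, f x⟫ ∂μ = 0) : f = 0 := by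
  rw [integral_eq_zero_iff_of_nonneg (fun x => real_inner_self_nonneg)
    (integrable_inner μ hf hf)] at h
  have := (hf.1.inner hf.1).ae_eq_iff_eq μ continuous_zero |>.1 h
  funext x
  exact inner_self_eq_zero.1 (congrFun this x)

theorem integral_inner_sub_left (μ : Measure X) [IsFiniteMeasure μ] {f f' g : X → G}
    (hf : f ∈ bddCont X G) (hf' : f' ∈ bddCont X G) (hg : g ∈ bddCont X G) :
    ∫ x, ⟪(f - f') x, g x⟫ ∂μ = (∫ x, ⟪f x, g x⟫ ∂μ) - ∫ x, ⟪f' x, g x⟫ ∂μ := by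
  rw [← integral_sub (integrable_inner μ hf hg) (integrable_inner μ hf' hg)]
  simp [inner_sub_left]

/-- Riesz representation in the range of a linear map from a finite-dimensional space to bounded
continuous functions. -/
theorem existsUnique_riesz (μ : Measure X) [IsFiniteMeasure μ] [μ.IsOpenPosMeasure]
    {W : Type*} [AddCommGroup W] [Module ℝ W] [Module.Finite ℝ W]
    (e : W →ₗ[ℝ] X → G) (he : ∀ w, e w ∈ bddCont X G) (L : W →ₗ[ℝ] ℝ)
    (hL : ∀ w, e w = 0 → L w = 0) :
    ∃! y : X → G, y ∈ LinearMap.range e ∧ ∀ w, ∫ x, ⟪y x, e w x⟫ ∂μ = L w := by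
  set V := LinearMap.range e with hV
  have hVb : ∀ v : V, V.subtype v ∈ bddCont X G := by
    rintro ⟨_, w, rfl⟩
    exact he w
  let b : V →ₗ[ℝ] Module.Dual ℝ V :=
    { toFun := fun v => pairing μ (hVb v) V.subtype hVb
      map_add' := fun v v' => by
        ext w
        simp only [pairing_apply, LinearMap.add_apply]
        rw [← integral_add (integrable_inner μ (hVb v) (hVb w))
          (integrable_inner μ (hVb v') (hVb w))]
        simp [inner_add_left]
      map_smul' := fun c v => by
        ext w
        simp only [pairing_apply, LinearMap.smul_apply, RingHom.id_apply, smul_eq_mul]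
        rw [← integral_const_mul]
        simp [inner_smul_left] }
  -- Definiteness makes the pairing nondegenerate, and in finite dimension an injective map to the
  -- dual is surjective.
  have hb : Function.Injective b := by
    rw [injective_iff_map_eq_zero]
    intro v hv
    have := LinearMap.congr_fun hv v
    exact Subtype.ext (eq_zero_of_integral_inner_self μ (hVb v) this)
  -- A linear section of the map onto its range. By `hL` the functional `L` does not depend on the
  -- chosen preimage, so `L ∘ₗ g` is `L` descended to the range.
  obtain ⟨g, hg⟩ := LinearMap.exists_rightInverse_of_surjective e.rangeRestrict
    e.range_rangeRestrict
  obtain ⟨v, hv⟩ := (LinearMap.injective_iff_surjective_of_finrank_eq_finrank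
    (Subspace.dual_finrank_eq (K := ℝ) (V := V)).symm).1 hb (L ∘ₗ g)
  have hgw : ∀ w, L (g (e.rangeRestrict w)) = L w := fun w => by
    have h1 := LinearMap.congr_fun hg (e.rangeRestrict w)
    have h2 : e (g (e.rangeRestrict w)) = e w := congrArg Subtype.val h1
    have := hL (g (e.rangeRestrict w) - w) (by rw [map_sub, h2, sub_self])
    rwa [map_sub, sub_eq_zero] at this
  have key : ∀ w, ∫ x, ⟪(v : X → G) x, e w x⟫ ∂μ = L w := fun w => by
    rw [← hgw w]
    exact LinearMap.congr_fun hv (e.rangeRestrict w)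
  refine ⟨v, ⟨v.2, key⟩, ?_⟩
  rintro y ⟨hy, hyw⟩
  -- The difference of two solutions is itself an admissible test function, hence orthogonal to
  -- itself.
  have hd : y - v ∈ V := V.sub_mem hy v.2
  obtain ⟨w, hw⟩ := hd
  have h0 : ∫ x, ⟪(y - v : X → G) x, (y - v : X → G) x⟫ ∂μ = 0 := by
    have := integral_inner_sub_left μ (hVb ⟨y, hy⟩) (hVb v) (he w)
    simp only [Submodule.subtype_apply] at this
    rw [hyw, key, sub_self, hw] at this
    exact this
  exact sub_eq_zero.1 (eq_zero_of_integral_inner_self μ (hw ▸ he w) h0)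

end Riesz

/-! ### Polynomials -/

theorem polyLE_natCast (k : ℕ) : polyLE k = MvPolynomial.restrictTotalDegree (Fin 3) ℝ k := by
  simp [polyLE]

instance (ℓ : ℤ) : Module.Finite ℝ (polyLE ℓ) := by
  by_cases h : 0 ≤ ℓ
  · rw [polyLE, if_pos h]
    infer_instance
  · rw [polyLE, if_neg h]
    infer_instance

theorem C_mem_polyLE (c : ℝ) (k : ℕ) : MvPolynomial.C c ∈ polyLE k := by
  rw [polyLE_natCast, MvPolynomial.mem_restrictTotalDegree]
  simp

theorem polyLE_mono_succ (k : ℕ) : polyLE k ≤ polyLE (k + 1) := by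
  intro p hp
  have h : polyLE ((k : ℤ) + 1) = polyLE ((k + 1 : ℕ) : ℤ) := by push_cast; rfl
  rw [h, polyLE_natCast, MvPolynomial.mem_restrictTotalDegree]
  rw [polyLE_natCast, MvPolynomial.mem_restrictTotalDegree] at hp
  omega

theorem pderiv_mem_polyLE {k : ℕ} {p : Poly3} (hp : p ∈ polyLE (k + 1)) (i : Fin 3) :
    MvPolynomial.pderiv i p ∈ polyLE k := by
  have h : polyLE ((k : ℤ) + 1) = polyLE ((k + 1 : ℕ) : ℤ) := by push_cast; rfl
  rw [h, polyLE_natCast, MvPolynomial.mem_restrictTotalDegree] at hp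
  rw [p.as_sum, map_sum]
  refine Submodule.sum_mem _ fun s hs => ?_
  rw [MvPolynomial.pderiv_monomial, polyLE_natCast, MvPolynomial.mem_restrictTotalDegree]
  rcases Nat.eq_zero_or_pos (s i) with h0 | h0
  · simp [h0]
  · refine (MvPolynomial.totalDegree_monomial_le _ _).trans ?_
    have h1 := (MvPolynomial.le_totalDegree hs).trans hp
    -- Here the variable occurs in the monomial, and removing one copy of it lowers the degree by
    -- exactly one; in the other case the derivative is zero.
    have h2 : s = (s - Finsupp.single i 1) + Finsupp.single i 1 := by
      rw [tsub_add_cancel_of_le]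
      rw [Finsupp.single_le_iff]
      exact h0
    rw [h2, Finsupp.sum_add_index' (by simp) (by simp)] at h1
    rw [Finsupp.sum_single_index rfl] at h1
    exact Nat.le_of_add_le_add_right h1

/-- Vectors of polynomials of degree at most `ℓ`. -/
def vecPolyLE (ℓ : ℤ) : Submodule ℝ (Fin 3 → Poly3) where
  carrier := {v | ∀ i, v i ∈ polyLE ℓ}
  zero_mem' := fun _ => Submodule.zero_mem _
  add_mem' := fun hv hw i => Submodule.add_mem _ (hv i) (hw i)
  smul_mem' := fun c _ hv i => Submodule.smul_mem _ c (hv i)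

instance (ℓ : ℤ) : Module.Finite ℝ (vecPolyLE ℓ) := by
  let f : vecPolyLE ℓ →ₗ[ℝ] Fin 3 → polyLE ℓ :=
    { toFun := fun v i => ⟨v.1 i, v.2 i⟩
      map_add' := fun _ _ => rfl
      map_smul' := fun _ _ => rfl }
  refine Module.Finite.of_injective f fun v w h => ?_
  ext1
  funext i
  exact congrArg Subtype.val (congrFun h i)

/-- The bridge between formal and analytic derivatives: the chain rule along a line, by induction on
the polynomial. All later arguments about vanishing gradients restrict to lines and use this. -/
theorem hasDerivAt_ev (p : Poly3) (x v : E3) (s : ℝ) :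
    HasDerivAt (fun s : ℝ => ev p (x + s • v)) ⟪vev (grad p) (x + s • v), v⟫ s := by
  have hX : ∀ i : Fin 3, HasDerivAt (fun s : ℝ => (x + s • v) i) (v i) s := fun i => by
    simpa using ((hasDerivAt_id s).mul_const (v i)).const_add (x i)
  have hin : ∀ q : Poly3, ⟪vev (grad q) (x + s • v), v⟫ =
      ∑ i, ev (MvPolynomial.pderiv i q) (x + s • v) * v i := fun q => by
    simp only [vev, grad, Inner.inner]
    simp [mul_comm]
  rw [hin]
  induction p using MvPolynomial.induction_on with
  | C a => simpa [ev] using hasDerivAt_const s a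
  | add p q hp hq =>
    have := hp.add hq
    simp only [ev, map_add, add_mul, Finset.sum_add_distrib] at this ⊢
    exact this
  | mul_X p i hp =>
    have := hp.mul (hX i)
    simp only [ev, map_mul, MvPolynomial.eval_X, MvPolynomial.pderiv_mul, map_add, add_mul,
      Finset.sum_add_distrib, MvPolynomial.pderiv_X] at this ⊢
    refine this.congr_deriv ?_
    symm
    congr 1
    · rw [Finset.sum_mul]
      exact Finset.sum_congr rfl fun j _ => by ring
    · rw [Finset.sum_eq_single i]
      · simp
      · intro j _ hj
        simp [Pi.single_eq_of_ne hj.symm]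
      · simp

theorem continuous_ev (p : Poly3) : Continuous (ev p) := by
  unfold ev
  exact (MvPolynomial.continuous_eval p).comp (by fun_prop)

theorem continuous_vev (v : Fin 3 → Poly3) : Continuous (vev v) := by
  unfold vev
  exact (PiLp.continuous_toLp 2 _).comp (continuous_pi fun i => continuous_ev (v i))

/-- The cross product, as a bilinear map. -/
def crossL : E3 →ₗ[ℝ] E3 →ₗ[ℝ] E3 :=
  LinearMap.mk₂ ℝ cross
    (fun a b c => by simp [cross])
    (fun r a b => by simp [cross])
    (fun a b c => by simp [cross])
    (fun r a b => by simp [cross])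

theorem crossL_apply (a b : E3) : crossL a b = cross a b := rfl

theorem continuous_cross_left (b : E3) : Continuous fun a => cross a b :=
  (crossL.flip b).continuous_of_finiteDimensional

/-- Restriction of polynomials to `X`. -/
def evL (X : Set E3) : Poly3 →ₗ[ℝ] X → ℝ where
  toFun p x := ev p x
  map_add' p q := by ext; simp [ev]
  map_smul' c p := by ext; simp [ev]

/-- Restriction of vectors of polynomials to `X`. -/
def vevL (X : Set E3) : (Fin 3 → Poly3) →ₗ[ℝ] X → E3 where
  toFun v x := vev v x
  map_add' p q := by ext; simp [ev, vev]
  map_smul' c p := by ext; simp [ev, vev]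

/-- The gradient, as a linear map. -/
def gradL : Poly3 →ₗ[ℝ] Fin 3 → Poly3 where
  toFun := grad
  map_add' p q := by ext1; simp [grad]
  map_smul' c p := by ext1; simp [grad]

/-- The curl, as a linear map. -/
def curlL : (Fin 3 → Poly3) →ₗ[ℝ] Fin 3 → Poly3 where
  toFun := curl
  map_add' p q := by
    funext i
    fin_cases i <;> simp [curl] <;> abel
  map_smul' c p := by
    funext i
    fin_cases i <;> simp [curl, smul_sub]

/-- The vector curl on `X`, as a linear map. -/
def vrotL (n : E3) (X : Set E3) : Poly3 →ₗ[ℝ] X → E3 :=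
  LinearMap.compLeft (crossL.flip n) X ∘ₗ vevL X ∘ₗ gradL

theorem inner_cross_right (a b : E3) : ⟪cross a b, b⟫ = 0 := by
  simp [cross, PiLp.inner_apply, Fin.sum_univ_three, crossProduct]
  ring

theorem cross_self (a : E3) : cross a a = 0 := by
  simp [cross]

/-- Crossing with $n$ kills the normal component, so the projection of the gradient on the face may
be omitted. This identifies the rotor with the trace $\mathrm{grad}\,p\times n_F$ that appears in
the element curl. -/
theorem vrotF_eq (n : E3) (p : Poly3) (x : E3) : vrotF n p x = cross (vev (grad p) x) n := by
  simp only [vrotF, rotNeg, gradF, ← crossL_apply, map_sub, map_smul, LinearMap.sub_apply,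
    LinearMap.smul_apply]
  simp [crossL_apply, cross_self]

theorem vrotL_apply (n : E3) (X : Set E3) (p : Poly3) (x : X) : vrotL n X p x = vrotF n p x :=
  (vrotF_eq n p x).symm

/-! ### Boundedness of polynomial fields on bounded sets -/

section Restrictions

variable {X : Set E3} (hX : Bornology.IsBounded X)
include hX

theorem comp_val_mem_bddCont {G : Type*} [NormedAddCommGroup G] [InnerProductSpace ℝ G]
    {f : E3 → G} (hf : Continuous f) : (fun x : X => f x) ∈ bddCont X G := by
  refine ⟨hf.comp continuous_subtype_val, ?_⟩
  obtain ⟨C, hC⟩ := hX.isCompact_closure.exists_bound_of_continuousOn hf.continuousOn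
  exact ⟨C, fun x => hC x (subset_closure x.2)⟩

theorem evL_mem_bddCont (p : Poly3) : evL X p ∈ bddCont X ℝ :=
  comp_val_mem_bddCont hX (continuous_ev p)

theorem vevL_mem_bddCont (v : Fin 3 → Poly3) : vevL X v ∈ bddCont X E3 :=
  comp_val_mem_bddCont hX (continuous_vev v)

theorem vrotL_mem_bddCont (n : E3) (p : Poly3) : vrotL n X p ∈ bddCont X E3 :=
  comp_val_mem_bddCont hX
    ((crossL.flip n).continuous_of_finiteDimensional.comp (continuous_vev (grad p)))

end Restrictions

end

end DDR

namespace DDR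

/-! ### One-sided sets -/

/-- Within `P`, near `y`, the set `S` is the side of the plane through `y` orthogonal to `ν` which
`σ • ν` points away from. -/
def OneSidedOn (P S : Set E3) (ν y : E3) (σ r : ℝ) : Prop :=
  ∀ z ∈ P, dist z y < r → (z ∈ S ↔ σ * ⟪ν, z - y⟫ < 0)

/-- A Lipschitz boundary cannot be a slit. Since $y$ is on the graph, moving from $y$ along the
graph direction $e$ enters $S$ and moving along $-e$ leaves it. If $e$ were orthogonal to $\nu$, the
point of $S$ reached along $e$ would contradict `hloc`; so $e$ is transversal and the point reached
along $-e$ is the one sought. -/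
theorem exists_notMem_of_hasLipschitzBoundary {P S : Set E3} (hSP : S ⊆ P)
    (hL : HasLipschitzBoundary P S) {ν y : E3} {r : ℝ} (hr : 0 < r) (hy : y ∈ closure S \ S)
    (hyP : y ∈ P) (hloc : ∀ z ∈ P, dist z y < r → ⟪ν, z - y⟫ = 0 → z ∉ S) :
    ∃ z ∈ P, dist z y < r ∧ ⟪ν, z - y⟫ ≠ 0 ∧ z ∉ S := by
  obtain ⟨e, he, heP, K, φ, r', hφ, hr', hS⟩ := hL y hy
  by_contra! hcon
  set g : E3 → ℝ := fun z => φ (z - ⟪e, z⟫ • e) - ⟪e, z⟫ with hg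
  have hgc : Continuous g := by
    have := hφ.continuous
    fun_prop
  have hgs : ∀ z ∈ P, dist z y < r' → (z ∈ S ↔ g z < 0) := fun z hz hd => by
    rw [hS z hz hd, hg, sub_neg]
  have hee : ⟪e, e⟫ = 1 := by rw [real_inner_self_eq_norm_sq, he, one_pow]
  have hgt : ∀ s : ℝ, g (y + s • e) = g y - s := fun s => by
    have : y + s • e - ⟪e, y + s • e⟫ • e = y - ⟪e, y⟫ • e := by
      rw [inner_add_right, inner_smul_right, hee, mul_one, add_smul]
      abel
    simp only [hg]
    rw [this, inner_add_right, inner_smul_right, hee]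
    ring
  -- $y$ is a limit of points where $g<0$, and not itself such a point.
  have hgy : g y = 0 := by
    refine le_antisymm ?_ ?_
    · by_contra! hpos
      obtain ⟨z, ⟨hz1, hz2⟩, hzS⟩ := mem_closure_iff.1 hy.1 ({z | 0 < g z} ∩ Metric.ball y r')
        ((isOpen_lt continuous_const hgc).inter Metric.isOpen_ball)
        ⟨hpos, Metric.mem_ball_self hr'⟩
      exact lt_asymm hz1 ((hgs z (hSP hzS) hz2).1 hzS)
    · by_contra! hneg
      exact hy.2 ((hgs y hyP (by simpa using hr')).2 hneg)
  have hd : ∀ s : ℝ, dist (y + s • e) y = |s| := fun s => by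
    simp [dist_eq_norm, norm_smul, he]
  obtain ⟨s, hs0, hs⟩ := exists_between (lt_min hr hr')
  obtain ⟨hsr, hsr'⟩ := lt_min_iff.1 hs
  have hin : ∀ c : ℝ, ⟪ν, y + c • e - y⟫ = c * ⟪ν, e⟫ := fun c => by
    rw [add_sub_cancel_left, inner_smul_right]
  have h1 : y + (-s) • e ∉ S := by
    rw [hgs _ (heP y hyP _) (by rw [hd, abs_neg, abs_of_pos hs0]; exact hsr'), hgt, hgy]
    linarith
  have h2 : y + s • e ∈ S := by
    rw [hgs _ (heP y hyP _) (by rw [hd, abs_of_pos hs0]; exact hsr'), hgt, hgy]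
    linarith
  by_cases h0 : ⟪ν, e⟫ = 0
  · exact hloc _ (heP y hyP _) (by rw [hd, abs_of_pos hs0]; exact hsr) (by rw [hin, h0, mul_zero]) h2
  · refine h1 (hcon _ (heP y hyP _) (by rw [hd, abs_neg, abs_of_pos hs0]; exact hsr) ?_)
    rw [hin]
    exact mul_ne_zero (by linarith) h0

/-- The plane orthogonal to $\nu$ cuts the part of `P` in the ball into two convex halves, which
miss the relative boundary of $S$. Each is connected, hence entirely inside or entirely outside $S$.
Both inside is a slit, excluded by `exists_notMem_of_hasLipschitzBoundary`; both outside contradicts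
$y\in\overline S$. -/
theorem exists_oneSidedOn {P S U : Set E3} (hP : Convex ℝ P) (hU : IsOpen U) (hSU : S = U ∩ P)
    (hL : HasLipschitzBoundary P S) {ν y : E3} {r : ℝ} (hr : 0 < r) (hy : y ∈ closure S \ S)
    (hyP : y ∈ P) (hloc : ∀ z ∈ P, dist z y < r → (z ∈ closure S \ S ↔ ⟪ν, z - y⟫ = 0)) :
    ∃ σ : ℝ, (σ = 1 ∨ σ = -1) ∧ OneSidedOn P S ν y σ r := by
  have hSP : S ⊆ P := hSU ▸ Set.inter_subset_right
  have hlin : ∀ τ : ℝ, IsLinearMap ℝ fun z : E3 => τ * ⟪ν, z⟫ := fun τ =>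
    ⟨fun a b => by rw [inner_add_right, mul_add], fun c a => by
      rw [inner_smul_right, smul_eq_mul]; ring⟩
  have hside : ∀ τ : ℝ, (∀ z ∈ P, dist z y < r → 0 < τ * ⟪ν, z - y⟫ → z ∈ S) ∨
      (∀ z ∈ P, dist z y < r → 0 < τ * ⟪ν, z - y⟫ → z ∉ S) := by
    intro τ
    set H : Set E3 := P ∩ Metric.ball y r ∩ {z | τ * ⟪ν, y⟫ < τ * ⟪ν, z⟫} with hH
    have hHc : IsPreconnected H :=
      ((hP.inter (convex_ball y r)).inter (convex_halfSpace_gt (hlin τ) _)).isPreconnected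
    have hmem : ∀ z ∈ P, dist z y < r → 0 < τ * ⟪ν, z - y⟫ → z ∈ H := fun z hz hd h =>
      ⟨⟨hz, hd⟩, by
        rw [inner_sub_right, mul_sub, sub_pos] at h
        exact h⟩
    have hbd : ∀ z ∈ H, z ∉ closure S \ S := by
      rintro z ⟨⟨hz, hd⟩, h⟩ hzb
      rw [hloc z hz hd, inner_sub_right, sub_eq_zero] at hzb
      simp [hzb] at h
    -- On the half-ball, `U` and the complement of the closure of `S` are disjoint open sets
    -- covering everything.
    by_cases hne : (H ∩ U).Nonempty
    · left
      intro z hz hd h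
      by_contra hzS
      have hzH := hmem z hz hd h
      obtain ⟨w, hw, hwU, hwS⟩ := hHc U (closure S)ᶜ hU isClosed_closure.isOpen_compl
        (fun w hw => by
          by_cases hwS : w ∈ S
          · rw [hSU] at hwS
            exact Or.inl hwS.1
          · exact Or.inr fun hc => hbd w hw ⟨hc, hwS⟩) hne
        ⟨z, hzH, fun hc => hbd z hzH ⟨hc, hzS⟩⟩
      exact hwS (subset_closure (hSU ▸ ⟨hwU, hw.1.1⟩))
    · right
      intro z hz hd h hzS
      rw [hSU] at hzS
      exact hne ⟨z, hmem z hz hd h, hzS.1⟩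
  have hzero : ∀ z ∈ P, dist z y < r → ⟪ν, z - y⟫ = 0 → z ∉ S := fun z hz hd h =>
    ((hloc z hz hd).2 h).2
  rcases hside 1 with h1 | h1 <;> rcases hside (-1) with h2 | h2
  · obtain ⟨z, hz, hd, hn, hzS⟩ := exists_notMem_of_hasLipschitzBoundary hSP hL hr hy hyP hzero
    rcases lt_or_gt_of_ne hn with h | h
    · exact absurd (h2 z hz hd (by linarith)) hzS
    · exact absurd (h1 z hz hd (by linarith)) hzS
  · refine ⟨-1, Or.inr rfl, fun z hz hd => ⟨fun hzS => ?_, fun h => h1 z hz hd (by linarith)⟩⟩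
    by_contra! hcon
    rcases hcon.eq_or_lt with h | h
    · exact hzero z hz hd (by linarith) hzS
    · exact h2 z hz hd h hzS
  · refine ⟨1, Or.inl rfl, fun z hz hd => ⟨fun hzS => ?_, fun h => h2 z hz hd (by linarith)⟩⟩
    by_contra! hcon
    rcases hcon.eq_or_lt with h | h
    · exact hzero z hz hd (by linarith) hzS
    · exact h1 z hz hd h hzS
  · obtain ⟨z, hzS, hd⟩ := Metric.mem_closure_iff.1 hy.1 r hr
    rw [dist_comm] at hd
    have hz := hSP hzS
    rcases lt_trichotomy ⟪ν, z - y⟫ 0 with h | h | h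
    · exact absurd hzS (h2 z hz hd (by linarith))
    · exact absurd hzS (hzero z hz hd h)
    · exact absurd hzS (h1 z hz hd (by linarith))

open Classical in
/-- A set which is one-sided at all points of a connected part `Y` of its boundary is so on the same
side. -/
theorem exists_oneSidedOn_pointsOut {P S Y : Set E3} {ν : E3} (hν : ‖ν‖ = 1)
    (hνP : ∀ y ∈ P, ∀ s : ℝ, y + s • ν ∈ P) (hY : IsPreconnected Y) (hYP : Y ⊆ P)
    (hYν : ∀ y ∈ Y, ∀ y' ∈ Y, ⟪ν, y - y'⟫ = 0)
    (h : ∀ y ∈ Y, ∃ r : ℝ, 0 < r ∧ ∃ σ : ℝ, (σ = 1 ∨ σ = -1) ∧ OneSidedOn P S ν y σ r) :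
    ∀ y ∈ Y, ∃ r : ℝ, 0 < r ∧ OneSidedOn P S ν y (if PointsOut S Y ν then 1 else -1) r := by
  have hνν : ⟪ν, ν⟫ = 1 := by rw [real_inner_self_eq_norm_sq, hν, one_pow]
  have hd : ∀ (y : E3) (s : ℝ), dist (y + s • ν) y = |s| := fun y s => by
    simp [dist_eq_norm, norm_smul, hν]
  have hin : ∀ (y : E3) (c : ℝ), ⟪ν, y + c • ν - y⟫ = c := fun y c => by
    rw [add_sub_cancel_left, inner_smul_right, hνν, mul_one]
  -- As `Y` is orthogonal to $\nu$, changing the base point within `Y` leaves the linear form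
  -- unchanged and only costs radius.
  have hmove : ∀ y ∈ Y, ∀ y' ∈ Y, ∀ σ r : ℝ, dist y' y < r → OneSidedOn P S ν y σ r →
      OneSidedOn P S ν y' σ (r - dist y' y) := by
    intro y hy y' hy' σ r _ h1 z hz hzd
    have : ⟪ν, z - y'⟫ = ⟪ν, z - y⟫ := by
      rw [← sub_eq_zero, ← inner_sub_right, sub_sub_sub_cancel_left]
      exact hYν y hy y' hy'
    rw [this]
    exact h1 z hz (by linarith [dist_triangle z y' y])
  have hnot : ∀ y ∈ Y, ∀ r r' : ℝ, 0 < r → 0 < r' → OneSidedOn P S ν y 1 r →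
      OneSidedOn P S ν y (-1) r' → False := by
    intro y hy r r' hr hr' h1 h2
    obtain ⟨s, hs0, hs⟩ := exists_between (lt_min hr hr')
    obtain ⟨hsr, hsr'⟩ := lt_min_iff.1 hs
    have e1 := h1 (y + s • ν) (hνP y (hYP hy) s) (by rwa [hd, abs_of_pos hs0])
    have e2 := h2 (y + s • ν) (hνP y (hYP hy) s) (by rwa [hd, abs_of_pos hs0])
    rw [hin] at e1 e2
    rw [e1] at e2
    have := e2.2 (by linarith)
    linarith
  split_ifs with hPO
  · intro y hy
    obtain ⟨r, hr, σ, rfl | rfl, hσ⟩ := h y hy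
    · exact ⟨r, hr, hσ⟩
    · exfalso
      obtain ⟨ε, hε, hPO⟩ := hPO y hy
      obtain ⟨s, hs0, hs⟩ := exists_between (lt_min hr hε)
      obtain ⟨hsr, hsε⟩ := lt_min_iff.1 hs
      have e2 := hσ (y + s • ν) (hνP y (hYP hy) s) (by rwa [hd, abs_of_pos hs0])
      rw [hin] at e2
      exact (hPO s hs0 hsε).2 (e2.2 (by linarith))
  -- The neighbourhoods where each sign is valid are open, cover `Y` and are disjoint on it, so one
  -- sign holds on the whole of `Y`. It cannot be $+1$ everywhere, since then $\nu$ would point out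
  -- at every point.
  · set O : ℝ → Set E3 := fun σ =>
      {z | ∃ y ∈ Y, ∃ r : ℝ, dist z y < r ∧ OneSidedOn P S ν y σ r} with hO
    have hOo : ∀ σ, IsOpen (O σ) := fun σ => by
      rw [isOpen_iff_mem_nhds]
      rintro z ⟨y, hy, r, hzr, h1⟩
      filter_upwards [Metric.isOpen_ball.mem_nhds (Metric.mem_ball.2 hzr)] with w hw
      exact ⟨y, hy, r, hw, h1⟩
    have hOY : ∀ σ, ∀ y ∈ Y, y ∈ O σ → ∃ r : ℝ, 0 < r ∧ OneSidedOn P S ν y σ r := by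
      rintro σ y hy ⟨y', hy', r, hyr, h1⟩
      exact ⟨_, sub_pos.2 hyr, hmove y' hy' y hy σ r hyr h1⟩
    have hcov : Y ⊆ O 1 ∪ O (-1) := fun y hy => by
      obtain ⟨r, hr, σ, rfl | rfl, hσ⟩ := h y hy
      · exact Or.inl ⟨y, hy, r, by simpa using hr, hσ⟩
      · exact Or.inr ⟨y, hy, r, by simpa using hr, hσ⟩
    have hempty : ¬ (Y ∩ O (-1)).Nonempty ∨ ¬ (Y ∩ O 1).Nonempty := by
      by_contra! hcon
      obtain ⟨y, hy, hy1, hy2⟩ := hY _ _ (hOo 1) (hOo (-1)) hcov hcon.2 hcon.1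
      obtain ⟨r, hr, h1⟩ := hOY 1 y hy hy1
      obtain ⟨r', hr', h2⟩ := hOY (-1) y hy hy2
      exact hnot y hy r r' hr hr' h1 h2
    rcases hempty with he | he
    · refine absurd (fun y hy => ?_) hPO
      obtain ⟨r, hr, h1⟩ := hOY 1 y hy ((hcov hy).resolve_right fun hc => he ⟨y, hy, hc⟩)
      refine ⟨r, hr, fun s hs0 hsr => ⟨?_, ?_⟩⟩
      · have e1 := h1 (y + (-s) • ν) (hνP y (hYP hy) _) (by rwa [hd, abs_neg, abs_of_pos hs0])
        rw [hin, neg_smul, ← sub_eq_add_neg] at e1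
        exact e1.2 (by linarith)
      · have e1 := h1 (y + s • ν) (hνP y (hYP hy) _) (by rwa [hd, abs_of_pos hs0])
        rw [hin] at e1
        rw [e1]
        linarith
    · intro y hy
      exact hOY (-1) y hy ((hcov hy).resolve_left fun hc => he ⟨y, hy, hc⟩)

/-! ### A function on the circle has jumps of zero sum -/

theorem eventually_int_ceil_add_floor_eq {u : ℝ} (hu : ∀ m : ℤ, u ≠ m) :
    ∀ᶠ v in nhds u, ⌈v⌉ + ⌊v⌋ = ⌈u⌉ + ⌊u⌋ := by
  have h1 : (⌊u⌋ : ℝ) < u := lt_of_le_of_ne (Int.floor_le u) (hu _).symm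
  have h2 : u < ⌊u⌋ + 1 := Int.lt_floor_add_one u
  have key : ∀ v : ℝ, (⌊u⌋ : ℝ) < v → v < ⌊u⌋ + 1 → ⌈v⌉ + ⌊v⌋ = (⌊u⌋ + 1) + ⌊u⌋ := by
    intro v hv1 hv2
    congr 1
    · rw [Int.ceil_eq_iff]
      push_cast
      exact ⟨by linarith, hv2.le⟩
    · rw [Int.floor_eq_iff]
      exact ⟨hv1.le, hv2⟩
  filter_upwards [Ioo_mem_nhds h1 h2] with v hv
  rw [key v hv.1 hv.2, key u h1 h2]

open Real in
-- The sum of ceiling and floor is a staircase of step 2 whose value at each jump is the midpoint,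
-- just as the sign vanishes at 0. Within half a period of the jump number $m$, the sign of $s$
-- minus the jump position is the sign of the sine.
theorem ceil_add_floor_eq_sign_sin {s : ℝ} {m : ℤ} (h : |s - 2 * π * m| < π) :
    ((⌈s / (2 * π)⌉ + ⌊s / (2 * π)⌋ : ℤ) : ℝ) = 2 * m + Real.sign (Real.sin s) := by
  have hpi := Real.pi_pos
  have hs : s = (s - 2 * π * m) + m * (2 * π) := by ring
  set u := s - 2 * π * m with hu
  have hdiv : s / (2 * π) = u / (2 * π) + m := by
    rw [hs]
    field_simp
  have hsin : Real.sin s = Real.sin u := by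
    rw [hs, Real.sin_add_int_mul_two_pi]
  rw [hdiv, hsin, Int.ceil_add_intCast, Int.floor_add_intCast]
  obtain ⟨hl, hr⟩ := abs_lt.1 h
  have h1 : u / (2 * π) < 1 := by rw [div_lt_one (by positivity)]; linarith
  have h2 : -1 < u / (2 * π) := by rw [lt_div_iff₀ (by positivity)]; linarith
  rcases lt_trichotomy u 0 with h0 | h0 | h0
  · have hneg : u / (2 * π) < 0 := div_neg_of_neg_of_pos h0 (by positivity)
    have hc : ⌈u / (2 * π)⌉ = 0 := by
      rw [Int.ceil_eq_iff]; constructor <;> push_cast <;> linarith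
    have hf : ⌊u / (2 * π)⌋ = -1 := by
      rw [Int.floor_eq_iff]; constructor <;> push_cast <;> linarith
    rw [hc, hf, Real.sign_of_neg (Real.sin_neg_of_neg_of_neg_pi_lt h0 hl)]
    push_cast
    ring
  · simp [h0]
    ring
  · have hpos : 0 < u / (2 * π) := by positivity
    have hc : ⌈u / (2 * π)⌉ = 1 := by
      rw [Int.ceil_eq_iff]; constructor <;> push_cast <;> linarith
    have hf : ⌊u / (2 * π)⌋ = 0 := by
      rw [Int.floor_eq_iff]; constructor <;> push_cast <;> linarith
    rw [hc, hf, Real.sign_of_pos (Real.sin_pos_of_pos_of_lt_pi h0 hr)]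
    push_cast
    ring

open Real in
-- Subtracting from $\chi$ the staircases with steps at the angles $\theta_i$, weighted by $j_i$,
-- removes all jumps and leaves a locally constant, hence constant, function. Over one period $\chi$
-- returns to its value while each staircase climbs by 2, so $2\sum_i j_i=0$.
theorem sum_jumps_eq_zero {I : Type*} [Fintype I] {χ : ℝ → ℝ} {θ j : I → ℝ}
    (hper : ∀ s, χ (s + 2 * π) = χ s)
    (hloc : ∀ s, (∀ (i : I) (m : ℤ), s ≠ θ i + 2 * π * m) → ∀ᶠ s' in nhds s, χ s' = χ s)
    (hjump : ∀ (i : I) (m : ℤ), ∀ᶠ s' in nhds (θ i + 2 * π * m),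
      χ s' = 1 + j i * Real.sign (Real.sin (s' - θ i)))
    (hdist : ∀ (i i' : I) (m : ℤ), θ i = θ i' + 2 * π * m → i = i') :
    ∑ i, j i = 0 := by
  classical
  have hpi := Real.pi_pos
  set c : I → ℝ → ℝ := fun i s =>
    ((⌈(s - θ i) / (2 * π)⌉ + ⌊(s - θ i) / (2 * π)⌋ : ℤ) : ℝ) with hc
  have hcloc : ∀ i s, (∀ m : ℤ, s ≠ θ i + 2 * π * m) → ∀ᶠ s' in nhds s, c i s' = c i s := by
    intro i s hs
    have hcont : Continuous fun s : ℝ => (s - θ i) / (2 * π) := by fun_prop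
    have := (hcont.tendsto s).eventually (eventually_int_ceil_add_floor_eq (fun m hm => hs m (by
      rw [div_eq_iff (by positivity)] at hm
      linarith)))
    filter_upwards [this] with s' hs'
    simp only [hc]
    rw [hs']
  have hψ : IsLocallyConstant fun s => χ s - ∑ i, j i * c i s := by
    rw [IsLocallyConstant.iff_eventually_eq]
    intro s
    by_cases hs : ∀ (i : I) (m : ℤ), s ≠ θ i + 2 * π * m
    · filter_upwards [hloc s hs, Filter.eventually_all.2 fun i => hcloc i s (hs i)] with s' h1 h2
      simp only [h1, h2]
    · push Not at hs
      obtain ⟨i, m, rfl⟩ := hs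
      -- Since the angles are distinct modulo $2\pi$, only the staircase of index `i` jumps here.
      have hothers : ∀ᶠ s' in nhds (θ i + 2 * π * m), ∀ i' ≠ i,
          c i' s' = c i' (θ i + 2 * π * m) := by
        rw [Filter.eventually_all]
        intro i'
        by_cases hi : i' = i
        · exact .of_forall fun s' h => absurd hi h
        · filter_upwards [hcloc i' (θ i + 2 * π * m) fun m' hm' => hi
            (hdist i i' (m' - m) (by push_cast; linarith)).symm] with s' hs' _
          exact hs'
      have hi : ∀ s' : ℝ, |s' - (θ i + 2 * π * m)| < π →
          c i s' = 2 * m + Real.sign (Real.sin (s' - θ i)) := fun s' hs' =>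
        ceil_add_floor_eq_sign_sin (by rwa [sub_sub])
      have hball : ∀ᶠ s' in nhds (θ i + 2 * π * m), |s' - (θ i + 2 * π * m)| < π := by
        have := Metric.ball_mem_nhds (θ i + 2 * π * m) hpi
        filter_upwards [this] with s' hs'
        rwa [Metric.mem_ball, Real.dist_eq] at hs'
      have hval : ∀ s', χ s' = 1 + j i * Real.sign (Real.sin (s' - θ i)) →
          (∀ i' ≠ i, c i' s' = c i' (θ i + 2 * π * m)) → |s' - (θ i + 2 * π * m)| < π →
          χ s' - ∑ i, j i * c i s' =
            1 - 2 * m * j i - ∑ i' ∈ Finset.univ.erase i, j i' * c i' (θ i + 2 * π * m) := by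
        intro s' h1 h2 h3
        rw [← Finset.add_sum_erase _ _ (Finset.mem_univ i), h1, hi s' h3,
          Finset.sum_congr rfl fun i' hi' => by rw [h2 i' (Finset.ne_of_mem_erase hi')]]
        ring
      filter_upwards [hjump i m, hothers, hball] with s' h1 h2 h3
      rw [hval s' h1 h2 h3, hval _ (hjump i m).self_of_nhds (fun _ _ => rfl) (by simpa using hpi)]
  -- Compare the constant function at the two ends of a period.
  have h1 := hψ.apply_eq_of_isPreconnected isPreconnected_univ (Set.mem_univ 0)
    (Set.mem_univ (0 + 2 * π))
  have h2 : ∀ i, c i (0 + 2 * π) = c i 0 + 2 := fun i => by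
    have : (0 + 2 * π - θ i) / (2 * π) = (0 - θ i) / (2 * π) + 1 := by
      field_simp
      ring
    simp only [hc]
    rw [this, Int.ceil_add_one, Int.floor_add_one]
    push_cast
    ring
  simp only [h2, hper, mul_add, Finset.sum_add_distrib, ← Finset.sum_mul] at h1
  linarith

end DDR

namespace DDR

/-! ### Orthonormal frames of `ℝ³` -/

theorem inner_cross_left (a b : E3) : ⟪cross a b, a⟫ = 0 := by
  simp [cross, PiLp.inner_apply, Fin.sum_univ_three, crossProduct]
  ring

theorem inner_cross_rotate (a b c : E3) : ⟪cross a b, c⟫ = ⟪cross b c, a⟫ := by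
  simp [cross, PiLp.inner_apply, Fin.sum_univ_three, crossProduct]
  ring

theorem inner_cross_cross (a b c d : E3) :
    ⟪cross a b, cross c d⟫ = ⟪a, c⟫ * ⟪b, d⟫ - ⟪a, d⟫ * ⟪b, c⟫ := by
  simp [cross, PiLp.inner_apply, Fin.sum_univ_three, crossProduct]
  ring

theorem norm_cross {a b : E3} (ha : ‖a‖ = 1) (hb : ‖b‖ = 1) (hab : ⟪a, b⟫ = 0) :
    ‖cross a b‖ = 1 := by
  have h := inner_cross_cross a b a b
  rw [real_inner_self_eq_norm_sq, real_inner_self_eq_norm_sq, real_inner_self_eq_norm_sq, ha, hb,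
    hab] at h
  rw [← sq_eq_sq₀ (norm_nonneg _) zero_le_one, h]
  norm_num

theorem cross_cross (a b c : E3) : cross (cross a b) c = ⟪a, c⟫ • b - ⟪b, c⟫ • a := by
  ext i
  fin_cases i <;>
  · simp [cross, PiLp.inner_apply, Fin.sum_univ_three, crossProduct]
    ring

theorem cross_anticomm (a b : E3) : cross a b = - cross b a := by
  ext i
  fin_cases i <;>
  · simp [cross, crossProduct]
    ring

/-- Expansion in the orthonormal frame `(t, a, t × a)`. -/
theorem eq_of_frame {t a : E3} (ht : ‖t‖ = 1) (ha : ‖a‖ = 1) (hta : ⟪t, a⟫ = 0) (v : E3) :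
    v = ⟪t, v⟫ • t + ⟪a, v⟫ • a + ⟪cross t a, v⟫ • cross t a := by
  have hon : Orthonormal ℝ ![t, a, cross t a] := by
    rw [orthonormal_iff_ite]
    have h1 : ⟪cross t a, t⟫ = 0 := inner_cross_left t a
    have h2 : ⟪cross t a, a⟫ = 0 := inner_cross_right t a
    have h3 : ‖cross t a‖ = 1 := norm_cross ht ha hta
    have h4 : ⟪t, cross t a⟫ = 0 := by rw [real_inner_comm]; exact h1
    have h5 : ⟪a, cross t a⟫ = 0 := by rw [real_inner_comm]; exact h2
    have h6 : ⟪a, t⟫ = 0 := by rw [real_inner_comm]; exact hta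
    intro i j
    fin_cases i <;> fin_cases j <;> simp [ht, ha, h1, h2, h3, h4, h5, h6, hta]
  obtain ⟨b, hb⟩ := Orthonormal.exists_orthonormalBasis_extension_of_card_eq
    (𝕜 := ℝ) (E := E3) (ι := Fin 3) (by simp) (v := ![t, a, cross t a]) (s := Set.univ)
    (hon.comp _ Subtype.val_injective)
  have := b.sum_repr v
  rw [Fin.sum_univ_three] at this
  simp only [b.repr_apply_apply, hb _ (Set.mem_univ _)] at this
  exact this.symm

namespace PolyMesh

variable {Ω : Set E3} (M : PolyMesh Ω)

/-! ### Incidence of faces and edges -/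

theorem mem_closure_edge {E : M.Edge} {x : E3} (hx : x ∈ closure (M.edge E)) :
    x ∈ M.edge E ∨ ∃ V, x = M.vert V := by
  rw [M.edge_eq, closure_openSegment, ← insert_endpoints_openSegment] at hx
  rcases hx with rfl | rfl | h
  · exact Or.inr ⟨_, rfl⟩
  · exact Or.inr ⟨_, rfl⟩
  · rw [M.edge_eq]
    exact Or.inl h

theorem mem_closure_face {F : M.Face} {x : E3} (hx : x ∈ closure (M.face F)) :
    x ∈ M.face F ∨ ∃ E, M.edge E ⊆ closure (M.face F) \ M.face F ∧ x ∈ closure (M.edge E) := by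
  by_cases h : x ∈ M.face F
  · exact Or.inl h
  · have hb : x ∈ closure (M.face F) \ M.face F := ⟨hx, h⟩
    rw [M.face_boundary] at hb
    simp only [Set.mem_iUnion] at hb
    obtain ⟨E, hE, hxE⟩ := hb
    exact Or.inr ⟨E, hE, hxE⟩

theorem notMem_closure_edge {F : M.Face} {x : E3} (hx : x ∈ M.face F) (E : M.Edge) :
    x ∉ closure (M.edge E) := by
  intro h
  rcases M.mem_closure_edge h with h | ⟨V, rfl⟩
  · exact Set.disjoint_left.1 (M.edge_face_disjoint E F) h hx
  · exact M.vert_notMem_face V F hx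

theorem eq_of_mem_closure_edge {E E' : M.Edge} {x : E3} (hx : x ∈ M.edge E)
    (h : x ∈ closure (M.edge E')) : E' = E := by
  rcases M.mem_closure_edge h with h | ⟨V, rfl⟩
  · by_contra hne
    exact Set.disjoint_left.1 (M.edge_disjoint E' E hne) h hx
  · exact absurd hx (M.vert_notMem_edge V E)

theorem eq_of_mem_closure_face {F F' : M.Face} {x : E3} (hx : x ∈ M.face F)
    (h : x ∈ closure (M.face F')) : F' = F := by
  rcases M.mem_closure_face h with h | ⟨E, -, h⟩
  · by_contra hne
    exact Set.disjoint_left.1 (M.face_disjoint F' F hne) h hx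
  · exact absurd h (M.notMem_closure_edge hx E)

/-- A closed face is the open face together with closed edges, and a point of an open edge lies in
no other closed edge. Hence a face whose closure touches the interior of $E$ has all of $E$ in its
boundary; the faces seen near a point of $E$ are exactly those in the cancellation sum. -/
theorem edge_subset_of_mem_closure_face {F : M.Face} {E : M.Edge} {x : E3} (hx : x ∈ M.edge E)
    (h : x ∈ closure (M.face F)) : M.edge E ⊆ closure (M.face F) \ M.face F := by
  rcases M.mem_closure_face h with h | ⟨E', hE', h⟩
  · exact absurd h (Set.disjoint_left.1 (M.edge_face_disjoint E F) hx)
  · rw [← M.eq_of_mem_closure_edge hx h]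
    exact hE'

theorem isClosed_plane (n : E3) (c : ℝ) : IsClosed (plane n c) :=
  isClosed_eq (by fun_prop) continuous_const

theorem convex_plane (n : E3) (c : ℝ) : Convex ℝ (plane n c) :=
  convex_hyperplane ⟨fun _ _ => inner_add_right _ _ _, fun _ _ => inner_smul_right _ _ _⟩ c

theorem face_subset_plane (F : M.Face) : M.face F ⊆ plane (M.normal F) (M.offset F) := by
  obtain ⟨U, -, h⟩ := M.face_isOpen F
  rw [h]
  exact Set.inter_subset_right

theorem closure_face_subset_plane (F : M.Face) :
    closure (M.face F) ⊆ plane (M.normal F) (M.offset F) :=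
  closure_minimal (M.face_subset_plane F) (isClosed_plane _ _)

theorem inner_sub_of_mem_plane {n : E3} {c : ℝ} {x y : E3} (hx : x ∈ plane n c)
    (hy : y ∈ plane n c) : ⟪n, x - y⟫ = 0 := by
  rw [inner_sub_right, sub_eq_zero]
  exact hx.trans hy.symm

theorem mem_plane_of_inner_sub {n : E3} {c : ℝ} {x y : E3} (hy : y ∈ plane n c)
    (h : ⟪n, x - y⟫ = 0) : x ∈ plane n c := by
  rw [inner_sub_right, sub_eq_zero] at h
  exact h.trans hy

theorem closure_diff_elem (T : M.Elem) :
    closure (M.elem T) \ M.elem T = frontier (M.elem T) := by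
  rw [(M.elem_isOpen T).frontier_eq]

/-! ### Position of elements with respect to faces -/

/-- The other closed faces are finitely many closed sets missing $y$, so near $y$ the boundary of
$T$ is the face $F$ alone, and $F$ is relatively open in its plane. -/
theorem exists_dist_lt_mem_frontier_iff {T : M.Elem} {F : M.Face}
    (hF : M.face F ⊆ frontier (M.elem T)) {y : E3} (hy : y ∈ M.face F) :
    ∃ r : ℝ, 0 < r ∧ ∀ z, dist z y < r →
      (z ∈ frontier (M.elem T) ↔ ⟪M.normal F, z - y⟫ = 0) := by
  obtain ⟨U, hU, hFU⟩ := M.face_isOpen F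
  have hyU : y ∈ U := by
    rw [hFU] at hy
    exact hy.1
  have hO : IsOpen (U ∩ (⋃ F' ∈ {F' | F' ≠ F}, closure (M.face F'))ᶜ) :=
    hU.inter (Set.Finite.isClosed_biUnion (Set.toFinite _)
      fun _ _ => isClosed_closure).isOpen_compl
  have hyO : y ∈ U ∩ (⋃ F' ∈ {F' | F' ≠ F}, closure (M.face F'))ᶜ := by
    refine ⟨hyU, fun h => ?_⟩
    simp only [Set.mem_iUnion] at h
    obtain ⟨F', hne, h⟩ := h
    exact hne (M.eq_of_mem_closure_face hy h)
  obtain ⟨r, hr, hball⟩ := Metric.isOpen_iff.1 hO y hyO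
  refine ⟨r, hr, fun z hz => ⟨fun h => ?_, fun h => ?_⟩⟩
  · rw [M.elem_frontier T] at h
    simp only [Set.mem_iUnion] at h
    obtain ⟨F', -, h⟩ := h
    have : F' = F := by
      by_contra hne
      refine (hball hz).2 ?_
      simp only [Set.mem_iUnion]
      exact ⟨F', hne, h⟩
    subst this
    exact inner_sub_of_mem_plane (M.closure_face_subset_plane F' h) (M.face_subset_plane F' hy)
  · apply hF
    rw [hFU]
    exact ⟨(hball hz).1, mem_plane_of_inner_sub (M.face_subset_plane F hy) h⟩

theorem omegaTF_eq (T : M.Elem) (F : M.Face) : M.omegaTF T F = 1 ∨ M.omegaTF T F = -1 := by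
  unfold omegaTF
  split_ifs <;> simp

theorem omegaFE_eq (F : M.Face) (E : M.Edge) : M.omegaFE F E = 1 ∨ M.omegaFE F E = -1 := by
  unfold omegaFE
  split_ifs <;> simp

/-- Flatness of the boundary near each point of $F$ gives one-sidedness there; connectedness of $F$
makes the side the same at all points, and it is the one recorded by $\omega_{TF}$. Passing to the
closure adds precisely the zero set of the linear form. -/
theorem exists_dist_lt_mem_elem_iff {T : M.Elem} {F : M.Face}
    (hF : M.face F ⊆ frontier (M.elem T)) {y : E3} (hy : y ∈ M.face F) :
    ∃ r : ℝ, 0 < r ∧ ∀ z, dist z y < r →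
      (z ∈ M.elem T ↔ M.omegaTF T F * ⟪M.normal F, z - y⟫ < 0) ∧
      (z ∈ closure (M.elem T) ↔ M.omegaTF T F * ⟪M.normal F, z - y⟫ ≤ 0) := by
  obtain ⟨r₁, hr₁, h₁⟩ := exists_oneSidedOn_pointsOut (P := Set.univ) (S := M.elem T)
    (Y := M.face F) (M.norm_normal F) (fun _ _ _ => trivial)
    (M.face_simplyConnected F).isPathConnected.isConnected.isPreconnected (Set.subset_univ _)
    (fun y hy y' hy' => inner_sub_of_mem_plane (M.face_subset_plane F hy)
      (M.face_subset_plane F hy')) (fun y hy => by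
        obtain ⟨r, hr, h⟩ := M.exists_dist_lt_mem_frontier_iff hF hy
        refine ⟨r, hr, exists_oneSidedOn convex_univ (M.elem_isOpen T) (by simp)
          (M.elem_lipschitz T) hr ?_ trivial fun z _ hz => ?_⟩
        · rw [closure_diff_elem]
          exact hF hy
        · rw [closure_diff_elem]
          exact h z hz) y hy
  obtain ⟨r₂, hr₂, h₂⟩ := M.exists_dist_lt_mem_frontier_iff hF hy
  refine ⟨min r₁ r₂, lt_min hr₁ hr₂, fun z hz => ?_⟩
  have e₁ : z ∈ M.elem T ↔ M.omegaTF T F * ⟪M.normal F, z - y⟫ < 0 :=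
    h₁ z trivial (hz.trans_le (min_le_left _ _))
  have e₂ := h₂ z (hz.trans_le (min_le_right _ _))
  refine ⟨e₁, ?_⟩
  have h0 : M.omegaTF T F ≠ 0 := by rcases M.omegaTF_eq T F with h | h <;> rw [h] <;> norm_num
  have e₃ : z ∈ closure (M.elem T) ↔ z ∈ M.elem T ∨ z ∈ frontier (M.elem T) := by
    rw [← closure_diff_elem]
    exact ⟨fun h => (em _).imp_right fun h' => ⟨h, h'⟩, fun h => h.elim (subset_closure ·) And.left⟩
  rw [e₃, e₁, e₂, le_iff_lt_or_eq, mul_eq_zero]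
  simp [h0]

/-! ### Position of faces with respect to edges -/

theorem norm_tangent (E : M.Edge) : ‖M.tangent E‖ = 1 := by
  have h : M.vert (M.tgt E) - M.vert (M.src E) ≠ 0 :=
    sub_ne_zero.2 fun h => M.src_ne_tgt E (M.vert_injective h).symm
  rw [tangent, norm_smul, norm_inv, norm_norm, inv_mul_cancel₀ (norm_ne_zero_iff.2 h)]

theorem edge_nonempty (E : M.Edge) : (M.edge E).Nonempty := by
  rw [M.edge_eq]
  exact ⟨_, midpoint_mem_openSegment _ _⟩

/-- Points of an edge differ by multiples of its tangent. -/
theorem exists_sub_eq_smul_tangent {E : M.Edge} {x y : E3} (hx : x ∈ closure (M.edge E))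
    (hy : y ∈ closure (M.edge E)) : ∃ s : ℝ, x - y = s • M.tangent E := by
  have key : ∀ x ∈ closure (M.edge E), ∃ s : ℝ, x - M.vert (M.src E) = s • M.tangent E := by
    intro x hx
    rw [M.edge_eq, closure_openSegment, segment_eq_image'] at hx
    obtain ⟨θ, -, rfl⟩ := hx
    have h : M.vert (M.tgt E) - M.vert (M.src E) ≠ 0 :=
      sub_ne_zero.2 fun h => M.src_ne_tgt E (M.vert_injective h).symm
    refine ⟨θ * ‖M.vert (M.tgt E) - M.vert (M.src E)‖, ?_⟩
    simp [tangent, smul_smul, norm_ne_zero_iff.2 h]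
  obtain ⟨s, hs⟩ := key x hx
  obtain ⟨s', hs'⟩ := key y hy
  exact ⟨s - s', by rw [sub_smul, ← hs, ← hs', sub_sub_sub_cancel_right]⟩

theorem exists_add_smul_tangent_mem_edge {E : M.Edge} {x : E3} (hx : x ∈ M.edge E) :
    ∃ r : ℝ, 0 < r ∧ ∀ s : ℝ, |s| < r → x + s • M.tangent E ∈ M.edge E := by
  have h : M.vert (M.tgt E) - M.vert (M.src E) ≠ 0 :=
    sub_ne_zero.2 fun h => M.src_ne_tgt E (M.vert_injective h).symm
  have hpos := norm_pos_iff.2 h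
  rw [M.edge_eq, openSegment_eq_image'] at hx ⊢
  obtain ⟨θ, ⟨h0, h1⟩, rfl⟩ := hx
  set l := ‖M.vert (M.tgt E) - M.vert (M.src E)‖ with hl
  refine ⟨min θ (1 - θ) * l, mul_pos (lt_min h0 (sub_pos.2 h1)) hpos, fun s hs => ?_⟩
  have hs' : |s / l| < min θ (1 - θ) := by
    rwa [abs_div, abs_of_pos hpos, div_lt_iff₀ hpos]
  obtain ⟨ha, hb⟩ := lt_min_iff.1 hs'
  obtain ⟨ha1, -⟩ := abs_lt.1 ha
  obtain ⟨-, hb1⟩ := abs_lt.1 hb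
  refine ⟨θ + s / l, ⟨by linarith, by linarith⟩, ?_⟩
  simp only [tangent]
  rw [add_smul, smul_smul, div_eq_mul_inv, add_assoc]

variable {M}

theorem inner_normal_tangent {F : M.Face} {E : M.Edge}
    (hE : M.edge E ⊆ closure (M.face F) \ M.face F) : ⟪M.normal F, M.tangent E⟫ = 0 := by
  obtain ⟨x, hx⟩ := M.edge_nonempty E
  obtain ⟨r, hr, h⟩ := M.exists_add_smul_tangent_mem_edge hx
  have h1 := h (r / 2) (by rw [abs_of_pos (by positivity)]; linarith)
  have := inner_sub_of_mem_plane (M.closure_face_subset_plane F (hE h1).1)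
    (M.closure_face_subset_plane F (hE hx).1)
  rw [add_sub_cancel_left, inner_smul_right] at this
  exact (mul_eq_zero.1 this).resolve_left (by positivity)

/-- The same local picture one dimension lower: near a point of $E$ the other closed edges are
absent, so the boundary of $F$ is the line of $E$. -/
theorem exists_dist_lt_mem_boundary_iff {F : M.Face} {E : M.Edge}
    (hE : M.edge E ⊆ closure (M.face F) \ M.face F) {x : E3} (hx : x ∈ M.edge E) :
    ∃ r : ℝ, 0 < r ∧ ∀ z ∈ plane (M.normal F) (M.offset F), dist z x < r →
      (z ∈ closure (M.face F) \ M.face F ↔ ⟪M.normalFE F E, z - x⟫ = 0) := by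
  obtain ⟨r₁, hr₁, h₁⟩ := M.exists_add_smul_tangent_mem_edge hx
  have hO : IsOpen (⋃ E' ∈ {E' | E' ≠ E}, closure (M.edge E'))ᶜ :=
    (Set.Finite.isClosed_biUnion (Set.toFinite _) fun _ _ => isClosed_closure).isOpen_compl
  have hxO : x ∈ (⋃ E' ∈ {E' | E' ≠ E}, closure (M.edge E'))ᶜ := by
    intro h
    simp only [Set.mem_iUnion] at h
    obtain ⟨E', hne, h⟩ := h
    exact hne (M.eq_of_mem_closure_edge hx h)
  obtain ⟨r₂, hr₂, hball⟩ := Metric.isOpen_iff.1 hO x hxO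
  have hnt := inner_normal_tangent hE
  have hxP := M.closure_face_subset_plane F (hE hx).1
  refine ⟨min r₁ r₂, lt_min hr₁ hr₂, fun z hzP hz => ⟨fun h => ?_, fun h => ?_⟩⟩
  · obtain ⟨E', hE', hzE'⟩ := (M.mem_closure_face h.1).resolve_left h.2
    have : E' = E := by
      by_contra hne
      refine hball (hz.trans_le (min_le_right _ _)) ?_
      simp only [Set.mem_iUnion]
      exact ⟨E', hne, hzE'⟩
    subst this
    obtain ⟨s, hs⟩ := M.exists_sub_eq_smul_tangent hzE' (subset_closure hx)
    rw [hs, inner_smul_right, normalFE, inner_cross_right, mul_zero]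
  -- In the frame $(n_F,t_E,n_{FE})$ only the tangential component of $z-x$ survives, so $z$ is on
  -- the line of $E$, close to $x$.
  · have hfr := eq_of_frame (M.norm_normal F) (M.norm_tangent E) hnt (z - x)
    rw [inner_sub_of_mem_plane hzP hxP, ← normalFE, h, zero_smul, zero_smul, zero_add,
      add_zero] at hfr
    have hzx : z = x + ⟪M.tangent E, z - x⟫ • M.tangent E := by
      rw [← hfr]
      abel
    rw [hzx]
    refine hE (h₁ _ ?_)
    have h2 := hz.trans_le (min_le_left _ _)
    rwa [dist_eq_norm, hfr, norm_smul, M.norm_tangent, mul_one] at h2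

theorem norm_normalFE {F : M.Face} {E : M.Edge}
    (hE : M.edge E ⊆ closure (M.face F) \ M.face F) : ‖M.normalFE F E‖ = 1 :=
  norm_cross (M.norm_normal F) (M.norm_tangent E) (inner_normal_tangent hE)

theorem exists_dist_lt_mem_face_iff {F : M.Face} {E : M.Edge}
    (hE : M.edge E ⊆ closure (M.face F) \ M.face F) {x : E3} (hx : x ∈ M.edge E) :
    ∃ r : ℝ, 0 < r ∧ ∀ z ∈ plane (M.normal F) (M.offset F), dist z x < r →
      (z ∈ M.face F ↔ M.omegaFE F E * ⟪M.normalFE F E, z - x⟫ < 0) ∧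
      (z ∈ closure (M.face F) ↔ M.omegaFE F E * ⟪M.normalFE F E, z - x⟫ ≤ 0) := by
  obtain ⟨U, hU, hFU⟩ := M.face_isOpen F
  have hEP : M.edge E ⊆ plane (M.normal F) (M.offset F) := fun y hy =>
    M.closure_face_subset_plane F (hE hy).1
  obtain ⟨r₁, hr₁, h₁⟩ := exists_oneSidedOn_pointsOut (P := plane (M.normal F) (M.offset F))
    (S := M.face F) (Y := M.edge E) (norm_normalFE hE)
    (fun y hy s => mem_plane_of_inner_sub hy (by
      rw [add_sub_cancel_left, inner_smul_right, real_inner_comm, normalFE, inner_cross_left,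
        mul_zero]))
    (by rw [M.edge_eq]; exact (convex_openSegment _ _).isPreconnected) hEP
    (fun y hy y' hy' => by
      obtain ⟨s, hs⟩ := M.exists_sub_eq_smul_tangent (subset_closure hy) (subset_closure hy')
      rw [hs, inner_smul_right, normalFE, inner_cross_right, mul_zero])
    (fun y hy => by
        obtain ⟨r, hr, h⟩ := exists_dist_lt_mem_boundary_iff hE hy
        exact ⟨r, hr, exists_oneSidedOn (convex_plane _ _) hU hFU
          (M.face_lipschitz F) hr (hE hy) (hEP hy) h⟩) x hx
  obtain ⟨r₂, hr₂, h₂⟩ := exists_dist_lt_mem_boundary_iff hE hx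
  refine ⟨min r₁ r₂, lt_min hr₁ hr₂, fun z hzP hz => ?_⟩
  have e₁ : z ∈ M.face F ↔ M.omegaFE F E * ⟪M.normalFE F E, z - x⟫ < 0 :=
    h₁ z hzP (hz.trans_le (min_le_left _ _))
  have e₂ := h₂ z hzP (hz.trans_le (min_le_right _ _))
  refine ⟨e₁, ?_⟩
  have h0 : M.omegaFE F E ≠ 0 := by rcases M.omegaFE_eq F E with h | h <;> rw [h] <;> norm_num
  have e₃ : z ∈ closure (M.face F) ↔ z ∈ M.face F ∨ z ∈ closure (M.face F) \ M.face F :=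
    ⟨fun h => (em _).imp_right fun h' => ⟨h, h'⟩, fun h => h.elim (subset_closure ·) And.left⟩
  rw [e₃, e₁, e₂, le_iff_lt_or_eq, mul_eq_zero]
  simp [h0]

end PolyMesh

end DDR

/-! ### Cancellation of orientations around an edge -/

namespace DDR

theorem exists_cos_sin_eq {u v : ℝ} (h : u ^ 2 + v ^ 2 = 1) :
    ∃ θ : ℝ, Real.cos θ = u ∧ Real.sin θ = v := by
  have hz : ‖(⟨u, v⟩ : ℂ)‖ = 1 := by
    rw [← sq_eq_sq₀ (norm_nonneg _) zero_le_one, Complex.sq_norm, Complex.normSq_mk, one_pow]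
    linear_combination h
  obtain ⟨θ, hθ⟩ := (Complex.norm_eq_one_iff _).1 hz
  refine ⟨θ, ?_, ?_⟩
  · rw [← Complex.exp_ofReal_mul_I_re, hθ]
  · rw [← Complex.exp_ofReal_mul_I_im, hθ]

open Classical in
-- Adding the open and closed indicators gives the symmetric value 1 on the interface itself, so the
-- jump formula holds there as well.
theorem ite_add_ite_eq_one_add_sign (c : ℝ) :
    ((if 0 < c then 1 else 0) + (if 0 ≤ c then 1 else 0) : ℝ) = 1 + Real.sign c := by
  rcases lt_trichotomy c 0 with h | rfl | h
  · simp [h.not_gt, h.not_ge, Real.sign_of_neg h]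
  · simp
  · simp [h, h.le, Real.sign_of_pos h]

namespace PolyMesh

variable {Ω : Set E3} {M : PolyMesh Ω}

/-- The position on circles around `E` of the faces containing `E` in their boundary: `F` is at the
angle `θ` in the plane with orthonormal basis `(a, t_E × a)`. -/
theorem exists_angle {F : M.Face} {E : M.Edge} (hE : M.edge E ⊆ closure (M.face F) \ M.face F)
    {a : E3} (ha : ‖a‖ = 1) (hta : ⟪M.tangent E, a⟫ = 0) :
    ∃ θ : ℝ, ∀ s : ℝ,
      ⟪M.normal F, Real.cos s • a + Real.sin s • cross (M.tangent E) a⟫ =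
        - (M.omegaFE F E * Real.sin (s - θ)) ∧
      ⟪M.normalFE F E, Real.cos s • a + Real.sin s • cross (M.tangent E) a⟫ =
        - (M.omegaFE F E * Real.cos (s - θ)) := by
  set t := M.tangent E with ht
  set n := M.normal F with hn
  set ω := M.omegaFE F E with hω
  have hω2 : ω * ω = 1 := by rcases M.omegaFE_eq F E with h | h <;> rw [hω, h] <;> norm_num
  have htn : ⟪t, n⟫ = 0 := by rw [real_inner_comm]; exact inner_normal_tangent hE
  have hexp := eq_of_frame (M.norm_tangent E) ha hta n
  rw [← ht, htn, zero_smul, zero_add] at hexp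
  have hnn : ⟪n, n⟫ = 1 := by rw [real_inner_self_eq_norm_sq, hn, M.norm_normal, one_pow]
  -- The two numbers are the coordinates, in the basis $(a,t\times a)$, of $-\omega_{FE}\,n_{FE}$,
  -- the unit vector pointing from $E$ into $F$; $\theta$ is its angle.
  have hsq : (- (ω * ⟪cross t a, n⟫)) ^ 2 + (ω * ⟪a, n⟫) ^ 2 = 1 := by
    have : ⟪n, n⟫ = ⟪a, n⟫ * ⟪a, n⟫ + ⟪cross t a, n⟫ * ⟪cross t a, n⟫ := by
      nth_rw 1 [hexp]
      rw [inner_add_left, inner_smul_left, inner_smul_left]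
      rfl
    rw [hnn] at this
    linear_combination -this + (⟪a, n⟫ * ⟪a, n⟫ + ⟪cross t a, n⟫ * ⟪cross t a, n⟫) * hω2
  obtain ⟨θ, hc, hs⟩ := exists_cos_sin_eq hsq
  have hb1 : ⟪n, cross t a⟫ = - (ω * Real.cos θ) := by
    rw [hc, real_inner_comm]
    linear_combination (-⟪cross t a, n⟫) * hω2
  have ha1 : ⟪n, a⟫ = ω * Real.sin θ := by
    rw [hs, real_inner_comm]
    linear_combination (-⟪a, n⟫) * hω2
  have ha2 : ⟪cross n t, a⟫ = - (ω * Real.cos θ) := by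
    rw [inner_cross_rotate, real_inner_comm, hb1]
  have hb2 : ⟪cross n t, cross t a⟫ = - (ω * Real.sin θ) := by
    rw [inner_cross_cross, hta, real_inner_self_eq_norm_sq, ht, M.norm_tangent, ha1]
    ring
  refine ⟨θ, fun s => ⟨?_, ?_⟩⟩
  · rw [inner_add_right, inner_smul_right, inner_smul_right, ha1, hb1, Real.sin_sub]
    ring
  · rw [normalFE, ← hn, ← ht, inner_add_right, inner_smul_right, inner_smul_right, ha2, hb2,
      Real.cos_sub]
    ring

open Real in
/-- The orientations of an edge by the faces of an element cancel. -/
theorem sum_omega_mul_omega_eq_zero (T : M.Elem) (E : M.Edge)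
    [Fintype {F : M.FaceOf T // M.edge E ⊆ closure (M.face F.1) \ M.face F.1}] :
    ∑ F : {F : M.FaceOf T // M.edge E ⊆ closure (M.face F.1) \ M.face F.1},
      M.omegaTF T F.1.1 * M.omegaFE F.1.1 E = 0 := by
  classical
  obtain ⟨x, hx⟩ := M.edge_nonempty E
  -- This face, not necessarily one of $T$, only supplies a unit vector orthogonal to the edge.
  obtain ⟨F₀, hF₀⟩ := M.edge_of_face E
  have ha := M.norm_normal F₀
  have hta : ⟪M.tangent E, M.normal F₀⟫ = 0 := by
    rw [real_inner_comm]; exact inner_normal_tangent hF₀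
  set a := M.normal F₀ with ha_def
  set b := cross (M.tangent E) a with hb_def
  have hb : ‖b‖ = 1 := norm_cross (M.norm_tangent E) ha hta
  choose θ hθ using fun F : {F : M.FaceOf T // M.edge E ⊆ closure (M.face F.1) \ M.face F.1} =>
    exists_angle F.2 ha hta
  have hev₁ : ∀ᶠ z in nhds x,
      ∀ F : {F : M.FaceOf T // M.edge E ⊆ closure (M.face F.1) \ M.face F.1},
      z ∈ plane (M.normal F.1.1) (M.offset F.1.1) →
      (z ∈ M.face F.1.1 ↔ M.omegaFE F.1.1 E * ⟪M.normalFE F.1.1 E, z - x⟫ < 0) ∧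
      (z ∈ closure (M.face F.1.1) ↔ M.omegaFE F.1.1 E * ⟪M.normalFE F.1.1 E, z - x⟫ ≤ 0) := by
    rw [Filter.eventually_all]
    intro F
    obtain ⟨r, hr, h⟩ := exists_dist_lt_mem_face_iff F.2 hx
    filter_upwards [Metric.ball_mem_nhds x hr] with z hz hzP
    exact h z hzP hz
  have hev₂ : ∀ᶠ z in nhds x, ∀ F : M.FaceOf T, z ∈ closure (M.face F.1) →
      M.edge E ⊆ closure (M.face F.1) \ M.face F.1 := by
    rw [Filter.eventually_all]
    intro F
    by_cases h : x ∈ closure (M.face F.1)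
    · exact .of_forall fun z _ => M.edge_subset_of_mem_closure_face hx h
    · filter_upwards [isClosed_closure.isOpen_compl.mem_nhds h] with z hz hz'
      exact absurd hz' hz
  obtain ⟨r, hr, hball⟩ := Metric.eventually_nhds_iff.1 (hev₁.and hev₂)
  -- The crude bound 2 on the norm of the unit-circle vector suffices: $2r/3<r$.
  set ρ := r / 3 with hρ_def
  have hρ : 0 < ρ := by positivity
  set γ : ℝ → E3 := fun s => x + ρ • (cos s • a + sin s • b) with hγ_def
  have hγc : Continuous γ := by fun_prop
  have hγx : ∀ s, γ s - x = ρ • (cos s • a + sin s • b) := fun s => add_sub_cancel_left _ _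
  have hγd : ∀ s, dist (γ s) x < r := fun s => by
    rw [dist_eq_norm, hγx, norm_smul, Real.norm_of_nonneg hρ.le]
    have h1 : ‖cos s • a + sin s • b‖ ≤ 2 := by
      refine (norm_add_le _ _).trans ?_
      rw [norm_smul, norm_smul, ha, hb, Real.norm_eq_abs, Real.norm_eq_abs]
      linarith [abs_cos_le_one s, abs_sin_le_one s]
    calc ρ * ‖cos s • a + sin s • b‖ ≤ ρ * 2 := by gcongr
      _ < r := by rw [hρ_def]; linarith
  have hγ₁ := fun s => (hball (hγd s)).1
  have hγ₂ := fun s => (hball (hγd s)).2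
  have hn : ∀ F s, ⟪M.normal F.1.1, γ s - x⟫ = - (ρ * M.omegaFE F.1.1 E * sin (s - θ F)) :=
    fun F s => by rw [hγx, inner_smul_right, (hθ F s).1]; ring
  have hnE : ∀ F s, ⟪M.normalFE F.1.1 E, γ s - x⟫ = - (ρ * M.omegaFE F.1.1 E * cos (s - θ F)) :=
    fun F s => by rw [hγx, inner_smul_right, (hθ F s).2]; ring
  have hω0 : ∀ F, M.omegaFE F E * M.omegaFE F E = 1 := fun F => by
    rcases M.omegaFE_eq F E with h | h <;> rw [h] <;> norm_num
  have hxP : ∀ F : {F : M.FaceOf T // M.edge E ⊆ closure (M.face F.1) \ M.face F.1},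
      x ∈ plane (M.normal F.1.1) (M.offset F.1.1) :=
    fun F => M.closure_face_subset_plane _ (F.2 hx).1
  -- the circle meets the face `F` at the angle `θ F`
  have hmem : ∀ F (m : ℤ), γ (θ F + 2 * π * m) ∈ M.face F.1.1 := fun F m => by
    have h0 : θ F + 2 * π * m - θ F = m * (2 * π) := by ring
    have hP : γ (θ F + 2 * π * m) ∈ plane (M.normal F.1.1) (M.offset F.1.1) := by
      refine mem_plane_of_inner_sub (hxP F) ?_
      rw [hn, h0, ← zero_add ((m : ℝ) * (2 * π)), Real.sin_add_int_mul_two_pi]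
      simp
    rw [(hγ₁ _ F hP).1, hnE, h0, Real.cos_int_mul_two_pi]
    linear_combination (-ρ) * hω0 F.1.1 + hρ
  -- A boundary point on the circle lies in a closed face, necessarily bordered by $E$. Lying in its
  -- plane forces the sine to vanish, and lying on its side of $E$ makes the cosine nonnegative,
  -- hence equal to 1.
  have hfront : ∀ s, γ s ∈ frontier (M.elem T) → ∃ F, ∃ m : ℤ, s = θ F + 2 * π * m := by
    intro s hs
    rw [M.elem_frontier T] at hs
    simp only [Set.mem_iUnion] at hs
    obtain ⟨F', hF', hs⟩ := hs
    let F : {F : M.FaceOf T // M.edge E ⊆ closure (M.face F.1) \ M.face F.1} :=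
      ⟨⟨F', hF'⟩, hγ₂ s ⟨F', hF'⟩ hs⟩
    have hP := M.closure_face_subset_plane F' hs
    have hsin : sin (s - θ F) = 0 := by
      have h1 := inner_sub_of_mem_plane hP (hxP F)
      rw [hn F s] at h1
      have h2 : M.omegaFE F.1.1 E ≠ 0 := fun h => by simpa [h] using hω0 F.1.1
      simpa [hρ.ne', h2] using h1
    have hcos : 0 ≤ cos (s - θ F) := by
      have h1 := (hγ₁ s F hP).2.1 hs
      rw [hnE F s] at h1
      have h2 : M.omegaFE F.1.1 E * -(ρ * M.omegaFE F.1.1 E * cos (s - θ F)) =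
          - (ρ * cos (s - θ F)) := by
        linear_combination (-ρ * cos (s - θ F)) * hω0 F.1.1
      rw [h2] at h1
      exact nonneg_of_mul_nonneg_right (by linarith : 0 ≤ ρ * cos (s - θ F)) hρ
    have hcos1 : cos (s - θ F) = 1 := by
      have := Real.sin_sq_add_cos_sq (s - θ F)
      rw [hsin] at this
      nlinarith
    obtain ⟨m, hm⟩ := (Real.cos_eq_one_iff _).1 hcos1
    exact ⟨F, m, by linarith⟩
  -- With $\chi$ the sum of the indicators of $T$ and of its closure along the circle, the jump
  -- coefficient at $F$ is $\omega_{TF}\omega_{FE}$. The four goals are periodicity, local constancy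
  -- off the faces, the jump formula, and distinctness of the angles, which comes from disjointness
  -- of the faces.
  refine sum_jumps_eq_zero
    (χ := fun s => (if γ s ∈ M.elem T then 1 else 0) + (if γ s ∈ closure (M.elem T) then 1 else 0))
    (θ := θ) (fun s => ?_) (fun s hs => ?_) (fun F m => ?_) (fun F F' m h => ?_)
  · simp only [hγ_def, Real.cos_add_two_pi, Real.sin_add_two_pi]
  · have hnf : γ s ∉ frontier (M.elem T) := fun h => by
      obtain ⟨F, m, h⟩ := hfront s h
      exact hs F m h
    by_cases hT : γ s ∈ M.elem T
    · filter_upwards [hγc.continuousAt.eventually ((M.elem_isOpen T).mem_nhds hT)] with s' hs'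
      have hs'' : γ s' ∈ M.elem T := hs'
      simp [hT, hs'', subset_closure hT, subset_closure hs'']
    · have hcl : γ s ∉ closure (M.elem T) := fun h => hnf (by
        rw [← closure_diff_elem]
        exact ⟨h, hT⟩)
      filter_upwards [hγc.continuousAt.eventually
        (isClosed_closure.isOpen_compl.mem_nhds hcl)] with s' hs'
      have hs'' : γ s' ∉ M.elem T := fun h => hs' (subset_closure h)
      have hs3 : γ s' ∉ closure (M.elem T) := hs'
      simp [hT, hcl, hs'', hs3]
  · obtain ⟨r', hr', h⟩ := M.exists_dist_lt_mem_elem_iff F.1.2 (hmem F m)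
    filter_upwards [hγc.continuousAt.eventually (Metric.ball_mem_nhds _ hr')] with s hs
    obtain ⟨h1, h2⟩ := h (γ s) hs
    have hin : M.omegaTF T F.1.1 * ⟪M.normal F.1.1, γ s - γ (θ F + 2 * π * m)⟫ =
        - (ρ * (M.omegaTF T F.1.1 * M.omegaFE F.1.1 E * sin (s - θ F))) := by
      have h3 : γ s - γ (θ F + 2 * π * m) = (γ s - x) - (γ (θ F + 2 * π * m) - x) := by abel
      rw [h3, inner_sub_right, inner_sub_of_mem_plane (M.face_subset_plane _ (hmem F m)) (hxP F),
        hn]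
      ring
    rw [hin] at h1 h2
    rw [neg_lt_zero, mul_pos_iff_of_pos_left hρ] at h1
    rw [neg_nonpos, mul_nonneg_iff_of_pos_left hρ] at h2
    simp only [h1, h2]
    rw [ite_add_ite_eq_one_add_sign]
    rcases M.omegaTF_eq T F.1.1 with h3 | h3 <;> rcases M.omegaFE_eq F.1.1 E with h4 | h4 <;>
      simp [h3, h4, Real.sign_neg]
  · have h1 := hmem F 0
    have h2 := hmem F' m
    rw [← h] at h2
    simp only [Int.cast_zero, mul_zero, add_zero] at h1
    have := M.eq_of_mem_closure_face h1 (subset_closure h2)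
    exact Subtype.ext (Subtype.ext this.symm)

end PolyMesh

end DDR

namespace DDR

noncomputable section

/-! ### Polynomials vanishing on flat sets -/

/-- Small steps from $x$ towards $z$ remain in $X$, because $P$ is convex and $U$ open. Only the
one-sided derivative is available, and it determines the directional derivative. -/
theorem inner_grad_eq_zero {X P U : Set E3} (hU : IsOpen U) (hX : X = U ∩ P) (hP : Convex ℝ P)
    {p : Poly3} (hp : ∀ x ∈ X, ev p x = 0) {x z : E3} (hx : x ∈ X) (hz : z ∈ P) :
    ⟪vev (grad p) x, z - x⟫ = 0 := by
  have hxP : x ∈ U ∩ P := hX ▸ hx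
  have hd := hasDerivAt_ev p x (z - x) 0
  rw [zero_smul, add_zero] at hd
  have hcont : Continuous fun s : ℝ => x + s • (z - x) := by fun_prop
  have hev : ∀ᶠ s in nhdsWithin (0 : ℝ) (Set.Ioi 0), ev p (x + s • (z - x)) = 0 := by
    have h1 : ∀ᶠ s in nhds (0 : ℝ), x + s • (z - x) ∈ U :=
      hcont.continuousAt.eventually (hU.mem_nhds (by simpa using hxP.1))
    filter_upwards [nhdsWithin_le_nhds h1, Ioo_mem_nhdsGT (zero_lt_one' ℝ)] with s hs hs1
    refine hp _ (hX ▸ ⟨hs, ?_⟩)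
    exact hP.add_smul_sub_mem hxP.2 hz ⟨hs1.1.le, hs1.2.le⟩
  have h0 : HasDerivWithinAt (fun s : ℝ => ev p (x + s • (z - x))) 0 (Set.Ioi 0) 0 := by
    refine (hasDerivWithinAt_const (0 : ℝ) (Set.Ioi 0) (0 : ℝ)).congr_of_eventuallyEq hev ?_
    simpa using hp x hx
  exact (uniqueDiffWithinAt_Ioi (0 : ℝ)).eq_deriv _ hd.hasDerivWithinAt h0

/-- Integrating along segments in small balls gives local constancy, and connectedness of $X$ gives
constancy. -/
theorem ev_eq_of_inner_grad_eq_zero {X P U : Set E3} (hU : IsOpen U) (hX : X = U ∩ P)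
    (hP : Convex ℝ P) (hXc : IsPreconnected X) {p : Poly3}
    (hp : ∀ x ∈ X, ∀ z ∈ P, ⟪vev (grad p) x, z - x⟫ = 0) {x y : E3} (hx : x ∈ X) (hy : y ∈ X) :
    ev p x = ev p y := by
  have hloc : ∀ a ∈ X, ∃ r : ℝ, 0 < r ∧ ∀ z ∈ P, dist z a < r → ev p z = ev p a := by
    intro a ha
    have haP : a ∈ U ∩ P := hX ▸ ha
    obtain ⟨r, hr, hball⟩ := Metric.isOpen_iff.1 hU a haP.1
    refine ⟨r, hr, fun z hz hd => ?_⟩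
    have hmem : ∀ s ∈ Set.Icc (0 : ℝ) 1, a + s • (z - a) ∈ X := fun s hs => by
      rw [hX]
      exact ⟨hball ((convex_ball a r).add_smul_sub_mem (Metric.mem_ball_self hr) hd hs),
        hP.add_smul_sub_mem haP.2 hz hs⟩
    have hder : ∀ s ∈ Set.Ico (0 : ℝ) 1,
        HasDerivWithinAt (fun s : ℝ => ev p (a + s • (z - a))) 0 (Set.Ici s) s := fun s hs => by
      have h1 := (hasDerivAt_ev p a (z - a) s).hasDerivWithinAt (s := Set.Ici s)
      have h2 := hp _ (hmem s ⟨hs.1, hs.2.le⟩) z hz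
      -- From a point of the segment the remaining direction is a multiple $1-s$ of the whole one,
      -- nonzero as long as $s<1$.
      have h3 : z - (a + s • (z - a)) = (1 - s) • (z - a) := by
        rw [sub_smul, one_smul]
        abel
      rw [h3, inner_smul_right] at h2
      rwa [(mul_eq_zero.1 h2).resolve_left (sub_pos.2 hs.2).ne'] at h1
    have := constant_of_has_deriv_right_zero
      ((continuous_ev p).comp (by fun_prop : Continuous fun s : ℝ => a + s • (z - a))).continuousOn
      hder 1 (by simp)
    simpa using this
  have := isPreconnected_iff_preconnectedSpace.1 hXc
  have hlc : IsLocallyConstant fun a : X => ev p a := by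
    rw [IsLocallyConstant.iff_eventually_eq]
    intro a
    obtain ⟨r, hr, h⟩ := hloc a a.2
    filter_upwards [Metric.ball_mem_nhds a hr] with z hz
    exact h z (hX ▸ z.2 : (z : E3) ∈ U ∩ P).2 hz
  exact hlc.apply_eq_of_preconnectedSpace ⟨x, hx⟩ ⟨y, hy⟩

/-! ### Normal gradients and the curl of a gradient -/

theorem inner_eq_zero_of_cross_eq_zero {n g v : E3} (hn : ‖n‖ = 1) (h : cross g n = 0)
    (hv : ⟪n, v⟫ = 0) : ⟪g, v⟫ = 0 := by
  have h1 := cross_cross g n n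
  rw [h, ← crossL_apply, map_zero, LinearMap.zero_apply, real_inner_self_eq_norm_sq, hn, one_pow,
    one_smul, eq_comm, sub_eq_zero] at h1
  rw [← h1, inner_smul_left, hv, mul_zero]

theorem cross_eq_zero_of_inner_eq_zero {n g : E3}
    (h : ∀ v, ⟪n, v⟫ = 0 → ⟪g, v⟫ = 0) : cross g n = 0 := by
  -- The test vector $(g\times n)\times n$ is tangential, and its product with $g$ is $-|g\times
  -- n|^2$.
  have h1 : ⟪n, cross (cross g n) n⟫ = 0 := by
    rw [real_inner_comm]
    exact inner_cross_right _ _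
  have h2 := h _ h1
  rw [real_inner_comm, inner_cross_rotate, cross_anticomm, inner_neg_left, neg_eq_zero] at h2
  exact inner_self_eq_zero.1 h2

theorem grad_C (c : ℝ) : grad (MvPolynomial.C c) = 0 := by
  funext i
  simp [grad]

/-- Partial derivatives commute, since their commutator is a derivation vanishing on the variables.
-/
theorem curl_grad (p : Poly3) : curl (grad p) = 0 := by
  have h : ∀ i j : Fin 3, MvPolynomial.pderiv i (MvPolynomial.pderiv j p) =
      MvPolynomial.pderiv j (MvPolynomial.pderiv i p) := fun i j => by
    have h0 : ⁅MvPolynomial.pderiv (R := ℝ) i, MvPolynomial.pderiv j⁆ = 0 :=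
      MvPolynomial.derivation_ext fun l => by
        rw [Derivation.commutator_apply]
        simp [MvPolynomial.pderiv_X, Pi.single_apply, apply_ite]
    have h1 := Derivation.commutator_apply (D1 := MvPolynomial.pderiv (R := ℝ) i)
      (D2 := MvPolynomial.pderiv j) p
    rw [h0, Derivation.zero_apply] at h1
    exact (sub_eq_zero.1 h1.symm)
  funext i
  fin_cases i <;> simp [curl, grad, h 1 2, h 2 0, h 0 1]

theorem vev_zero (x : E3) : vev 0 x = 0 := by
  ext i
  simp [vev, ev]

theorem ev_C (c : ℝ) (x : E3) : ev (MvPolynomial.C c) x = c := by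
  simp [ev]

theorem ev_sub (p q : Poly3) (x : E3) : ev (p - q) x = ev p x - ev q x := by
  simp [ev]

theorem real_inner_eq_mul (a b : ℝ) : ⟪a, b⟫ = a * b := by
  simp [mul_comm]

/-! ### The spaces of polynomial functions as ranges of linear maps -/

theorem mem_polyOn_iff {X : Set E3} {ℓ : ℤ} {f : X → ℝ} :
    f ∈ polyOn X ℓ ↔ f ∈ LinearMap.range (evL X ∘ₗ (polyLE ℓ).subtype) := by
  constructor
  · rintro ⟨p, hp, h⟩
    exact ⟨⟨p, hp⟩, funext fun x => (h x).symm⟩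
  · rintro ⟨⟨p, hp⟩, rfl⟩
    exact ⟨p, hp, fun x => rfl⟩

theorem mem_vecPolyOn_iff {X : Set E3} {ℓ : ℤ} {f : X → E3} :
    f ∈ vecPolyOn X ℓ ↔ f ∈ LinearMap.range (vevL X ∘ₗ (vecPolyLE ℓ).subtype) := by
  constructor
  · intro h
    choose p hp hpf using h
    refine ⟨⟨p, hp⟩, funext fun x => ?_⟩
    ext i
    exact (hpf i x).symm
  · rintro ⟨⟨p, hp⟩, rfl⟩ i
    exact ⟨p i, hp i, fun x => rfl⟩

theorem mem_golyT_iff {X : Set E3} {ℓ : ℤ} {f : X → E3} :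
    f ∈ golyT X ℓ ↔ f ∈ LinearMap.range (vevL X ∘ₗ gradL ∘ₗ (polyLE (ℓ + 1)).subtype) := by
  constructor
  · rintro ⟨p, hp, h⟩
    exact ⟨⟨p, hp⟩, funext fun x => (h x).symm⟩
  · rintro ⟨⟨p, hp⟩, rfl⟩
    exact ⟨p, hp, fun x => rfl⟩

theorem mem_rolyF_iff {n : E3} {X : Set E3} {ℓ : ℤ} {f : X → E3} :
    f ∈ rolyF n X ℓ ↔ f ∈ LinearMap.range (vrotL n X ∘ₗ (polyLE (ℓ + 1)).subtype) := by
  constructor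
  · rintro ⟨p, hp, h⟩
    exact ⟨⟨p, hp⟩, funext fun x => ((h x).trans (vrotL_apply n X p x).symm).symm⟩
  · rintro ⟨⟨p, hp⟩, rfl⟩
    exact ⟨p, hp, fun x => vrotL_apply n X p x⟩

/-- The space of tangential polynomial fields. -/
def tanPoly (n : E3) (X : Set E3) (ℓ : ℤ) : Submodule ℝ (X → E3) where
  carrier := tanPolyOn n X ℓ
  zero_mem' := ⟨mem_vecPolyOn_iff.2 (Submodule.zero_mem _), fun x => by simp⟩
  add_mem' := fun {u v} hu hv =>
    ⟨mem_vecPolyOn_iff.2 (Submodule.add_mem _ (mem_vecPolyOn_iff.1 hu.1) (mem_vecPolyOn_iff.1 hv.1)),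
      fun x => by rw [Pi.add_apply, inner_add_left, hu.2, hv.2, add_zero]⟩
  smul_mem' := fun c {u} hu =>
    ⟨mem_vecPolyOn_iff.2 (Submodule.smul_mem _ c (mem_vecPolyOn_iff.1 hu.1)),
      fun x => by rw [Pi.smul_apply, inner_smul_left, hu.2, mul_zero]⟩

instance (n : E3) (X : Set E3) (ℓ : ℤ) : Module.Finite ℝ (tanPoly n X ℓ) :=
  Submodule.finiteDimensional_of_le
    (S₂ := LinearMap.range (vevL X ∘ₗ (vecPolyLE ℓ).subtype))
    fun _ hu => mem_vecPolyOn_iff.1 hu.1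

section Bounded

variable {X : Set E3} (hX : Bornology.IsBounded X)
include hX

theorem mem_bddCont_of_mem_polyOn {ℓ : ℤ} {f : X → ℝ} (hf : f ∈ polyOn X ℓ) :
    f ∈ bddCont X ℝ := by
  obtain ⟨w, rfl⟩ := mem_polyOn_iff.1 hf
  exact evL_mem_bddCont hX _

theorem mem_bddCont_of_mem_vecPolyOn {ℓ : ℤ} {f : X → E3} (hf : f ∈ vecPolyOn X ℓ) :
    f ∈ bddCont X E3 := by
  obtain ⟨w, rfl⟩ := mem_vecPolyOn_iff.1 hf
  exact vevL_mem_bddCont hX _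

theorem mem_bddCont_of_mem_golyT {ℓ : ℤ} {f : X → E3} (hf : f ∈ golyT X ℓ) :
    f ∈ bddCont X E3 := by
  obtain ⟨w, rfl⟩ := mem_golyT_iff.1 hf
  exact vevL_mem_bddCont hX _

theorem mem_bddCont_of_mem_rolyT {ℓ : ℤ} {f : X → E3} (hf : f ∈ rolyT X ℓ) :
    f ∈ bddCont X E3 := by
  obtain ⟨w, -, h⟩ := hf
  rw [show f = vevL X (curl w) from funext h]
  exact vevL_mem_bddCont hX _

theorem mem_bddCont_of_mem_rolyF {n : E3} {ℓ : ℤ} {f : X → E3} (hf : f ∈ rolyF n X ℓ) :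
    f ∈ bddCont X E3 := by
  obtain ⟨w, rfl⟩ := mem_rolyF_iff.1 hf
  exact vrotL_mem_bddCont hX _ _

end Bounded

theorem grad_mem_vecPolyLE {k : ℕ} {p : Poly3} (hp : p ∈ polyLE (k + 1)) :
    grad p ∈ vecPolyLE k :=
  fun i => pderiv_mem_polyLE hp i

theorem vrotL_mem_tanPoly {n : E3} {X : Set E3} {k : ℕ} {p : Poly3} (hp : p ∈ polyLE (k + 1)) :
    vrotL n X p ∈ tanPoly n X k := by
  refine ⟨?_, fun x => inner_cross_right _ _⟩
  have hg := grad_mem_vecPolyLE hp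
  -- The coefficients are the matrix entries of $v\mapsto v\times n$, applied to the gradient.
  let q : Fin 3 → Poly3 := fun i => ∑ j, (cross (EuclideanSpace.single j 1) n) i • grad p j
  refine mem_vecPolyOn_iff.2 ⟨⟨q, fun i =>
    Submodule.sum_mem _ fun j _ => Submodule.smul_mem _ _ (hg j)⟩, funext fun x => ?_⟩
  ext i
  change ev (q i) x = (cross (vev (grad p) x) n) i
  fin_cases i <;>
  · simp [q, cross, crossProduct, vev, ev, Fin.sum_univ_three, MvPolynomial.smul_eval]
    ring

/-! ### Problems with test functions in a sum of orthogonal spaces -/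

section Orthogonal

variable {X : Type*} [TopologicalSpace X] [MeasurableSpace X] [BorelSpace X]
  {G : Type*} [NormedAddCommGroup G] [InnerProductSpace ℝ G]

/-- The `L²`-orthogonal complement of the range of `g` in `A`. -/
def perpRange (μ : Measure X) [IsFiniteMeasure μ] {W : Type*} [AddCommGroup W] [Module ℝ W]
    (A : Submodule ℝ (X → G)) (hA : A ≤ bddCont X G) (g : W →ₗ[ℝ] X → G) (hg : ∀ w, g w ∈ A) :
    Submodule ℝ (X → G) where
  carrier := {v | v ∈ A ∧ ∀ w, ∫ x, ⟪v x, g w x⟫ ∂μ = 0}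
  zero_mem' := ⟨A.zero_mem, fun w => by simp⟩
  add_mem' := by
    rintro u v ⟨hu, hu'⟩ ⟨hv, hv'⟩
    refine ⟨A.add_mem hu hv, fun w => ?_⟩
    simp only [Pi.add_apply, inner_add_left]
    rw [integral_add (integrable_inner μ (hA hu) (hA (hg w)))
      (integrable_inner μ (hA hv) (hA (hg w))), hu', hv', add_zero]
  smul_mem' := by
    rintro c v ⟨hv, hv'⟩
    refine ⟨A.smul_mem c hv, fun w => ?_⟩
    simp only [Pi.smul_apply, real_inner_smul_left]
    rw [integral_const_mul, hv', mul_zero]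

theorem integral_inner_add_right (μ : Measure X) [IsFiniteMeasure μ] {f g h : X → G}
    (hf : f ∈ bddCont X G) (hg : g ∈ bddCont X G) (hh : h ∈ bddCont X G) :
    ∫ x, ⟪f x, g x + h x⟫ ∂μ = (∫ x, ⟪f x, g x⟫ ∂μ) + ∫ x, ⟪f x, h x⟫ ∂μ := by
  rw [← integral_add (integrable_inner μ hf hg) (integrable_inner μ hf hh)]
  simp only [inner_add_right]

/-- Problems whose test space is the sum of the range of `g` and of its orthogonal complement. -/
theorem existsUnique_of_range_add_perpRange (μ : Measure X) [IsFiniteMeasure μ]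
    [μ.IsOpenPosMeasure] {W : Type*} [AddCommGroup W] [Module ℝ W] [Module.Finite ℝ W]
    (A : Submodule ℝ (X → G)) [Module.Finite ℝ A] (hA : A ≤ bddCont X G) (g : W →ₗ[ℝ] X → G)
    (hg : ∀ w, g w ∈ A) (L : W →ₗ[ℝ] ℝ) (hL : ∀ w, g w = 0 → L w = 0) {f : X → G}
    (hf : f ∈ bddCont X G) :
    ∃! y, y ∈ A ∧ ∀ w, ∀ v ∈ perpRange μ A hA g hg,
      ∫ x, ⟪y x, g w x + v x⟫ ∂μ = L w + ∫ x, ⟪f x, v x⟫ ∂μ := by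
  set P := perpRange μ A hA g hg with hP
  have hPA : P ≤ A := fun v hv => hv.1
  have : Module.Finite ℝ P := Submodule.finiteDimensional_of_le hPA
  have hPb : ∀ v : P, P.subtype v ∈ bddCont X G := fun v => hA (hPA v.2)
  have hgb : ∀ w, g w ∈ bddCont X G := fun w => hA (hg w)
  let e : W × P →ₗ[ℝ] X → G := g.coprod P.subtype
  let L' : W × P →ₗ[ℝ] ℝ := L.coprod (pairing μ hf P.subtype hPb)
  have heb : ∀ w, e w ∈ bddCont X G := fun w => Submodule.add_mem _ (hgb w.1) (hPb w.2)
  -- Every field of `A` is its orthogonal projection on the range of `g`, obtained by Riesz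
  -- representation, plus a remainder in the complement.
  have hrange : LinearMap.range e = A := by
    apply le_antisymm
    · rintro _ ⟨w, rfl⟩
      exact A.add_mem (hg w.1) (hPA w.2.2)
    · intro v hv
      obtain ⟨y, ⟨⟨w, rfl⟩, hy⟩, -⟩ := existsUnique_riesz μ g hgb (pairing μ (hA hv) g hgb)
        fun w hw => by simp [hw]
      refine ⟨(w, ⟨v - g w, A.sub_mem hv (hg w), fun w' => ?_⟩), ?_⟩
      · rw [integral_inner_sub_left μ (hA hv) (hgb w) (hgb w'), hy w', pairing_apply, sub_self]
      · simp [e]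
  -- If $g(w)+v=0$, then $g(w)$ is orthogonal to itself, so both summands vanish and `hL` applies.
  have hker : ∀ w, e w = 0 → L' w = 0 := by
    rintro ⟨w, v⟩ hwv
    have h1 : g w + (v : X → G) = 0 := hwv
    have h2 : (v : X → G) = - g w := (neg_eq_of_add_eq_zero_right h1).symm
    have h3 : g w = 0 := by
      refine eq_zero_of_integral_inner_self μ (hgb w) ?_
      have := v.2.2 w
      rw [h2] at this
      simpa [inner_neg_left, integral_neg] using this
    have h4 : (v : X → G) = 0 := by rw [h2, h3, neg_zero]
    have h5 : v = 0 := Subtype.ext h4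
    simp [L', hL w h3, h5]
  refine (existsUnique_congr fun y => ?_).1 (existsUnique_riesz μ e heb L' hker)
  rw [hrange]
  refine and_congr_right fun _ => ⟨fun h w v hv => h (w, ⟨v, hv⟩), fun h w => h w.1 w.2 w.2.2⟩

end Orthogonal

/-- Restricting a test space of polynomials to those of zero average is harmless for conditions which
do not depend on additive constants. -/
theorem forall_zeroAverage_iff {X : Set E3} (hX : Bornology.IsBounded X) (hne : X.Nonempty) {d : ℕ}
    [IsFiniteMeasure (μHE[d] : Measure X)] [(μHE[d] : Measure X).IsOpenPosMeasure] {k : ℕ}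
    {Q : Poly3 → Prop} (hQ : ∀ r c, r ∈ polyLE (k + 1) → Q (r - MvPolynomial.C c) → Q r) :
    (∀ r ∈ polyLE (k + 1), ∫ x : X, ev r x ∂μHE[d] = 0 → Q r) ↔ ∀ r ∈ polyLE (k + 1), Q r := by
  refine ⟨fun h r hr => ?_, fun h r hr _ => h r hr⟩
  have : Nonempty X := hne.to_subtype
  set m := (μHE[d] : Measure X).real Set.univ with hm
  have hm0 : m ≠ 0 := by
    rw [hm, Measure.real, ENNReal.toReal_ne_zero]
    exact ⟨(isOpen_univ.measure_pos _ Set.univ_nonempty).ne', measure_ne_top _ _⟩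
  -- The constant subtracted is the mean value of `r`.
  refine hQ r (m⁻¹ * ∫ x : X, ev r x ∂μHE[d]) hr (h _ (Submodule.sub_mem _ hr
    (polyLE_mono_succ k (C_mem_polyLE _ k))) ?_)
  have hint : Integrable (fun x : X => ev r x) μHE[d] := by
    have := integrable_inner (μHE[d] : Measure X) (evL_mem_bddCont hX 1) (evL_mem_bddCont hX r)
    simpa [evL, ev] using this
  simp only [ev_sub, ev_C]
  rw [integral_sub hint (integrable_const _), integral_const, smul_eq_mul, ← hm,
    mul_inv_cancel_left₀ hm0, sub_self]

end

end DDR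

namespace DDR

noncomputable section

namespace PolyMesh

variable {Ω : Set E3} {M : PolyMesh Ω} {T : M.Elem}

/-! ### Measures of elements, faces and edges -/

theorem face_isBounded (F : M.FaceOf T) : Bornology.IsBounded (M.face F.1) :=
  (M.elem_isBounded T).closure.subset (F.2.trans frontier_subset_closure)

theorem edge_isBounded (E : M.Edge) : Bornology.IsBounded (M.edge E) := by
  have h : Bornology.IsBounded (closure (M.edge E)) := by
    rw [M.edge_eq, closure_openSegment, segment_eq_image]
    exact (isCompact_Icc.image (by fun_prop)).isBounded
  exact h.subset subset_closure

instance (T : M.Elem) : IsFiniteMeasure (μHE[3] : Measure (M.elem T)) :=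
  isFiniteMeasure_space (M.elem_isBounded T)

instance (T : M.Elem) : (μHE[3] : Measure (M.elem T)).IsOpenPosMeasure :=
  isOpenPosMeasure_space (M.elem_isOpen T)

instance (F : M.FaceOf T) : IsFiniteMeasure (μHE[2] : Measure (M.face F.1)) :=
  isFiniteMeasure_plane (M.norm_normal F.1) (face_isBounded F) (M.face_subset_plane F.1)

instance (F : M.Face) : (μHE[2] : Measure (M.face F)).IsOpenPosMeasure := by
  obtain ⟨U, hU, h⟩ := M.face_isOpen F
  exact isOpenPosMeasure_plane (M.norm_normal F) hU h

instance (E : M.Edge) : IsFiniteMeasure (μHE[1] : Measure (M.edge E)) := by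
  rw [M.edge_eq]
  exact isFiniteMeasure_openSegment fun h => M.src_ne_tgt E (M.vert_injective h)

/-! ### Polynomials on elements, faces and edges -/

theorem eq_zero_of_subset_closure {X Y : Set E3} (hXY : Y ⊆ closure X) {p : Poly3}
    (hp : ∀ x ∈ X, ev p x = 0) : ∀ y ∈ Y, ev p y = 0 := fun _ hy =>
  closure_minimal (t := {x | ev p x = 0}) hp (isClosed_eq (continuous_ev p) continuous_const)
    (hXY hy)

theorem vev_grad_eq_zero_of_elem {p : Poly3} (hp : ∀ x ∈ M.elem T, ev p x = 0) :
    ∀ x ∈ M.elem T, vev (grad p) x = 0 := fun x hx => by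
  -- All directions are allowed in an open set; moving along the gradient itself gives its squared
  -- norm.
  have h := inner_grad_eq_zero (M.elem_isOpen T) (Set.inter_univ _).symm convex_univ hp hx
    (Set.mem_univ (x + vev (grad p) x))
  rw [add_sub_cancel_left] at h
  exact inner_self_eq_zero.1 h

theorem ev_eq_of_vev_grad_eq_zero {p : Poly3} (hp : ∀ x ∈ M.elem T, vev (grad p) x = 0) :
    ∃ c, ∀ x ∈ M.elem T, ev p x = c := by
  obtain ⟨y, hy⟩ := (M.elem_simplyConnected T).nonempty
  exact ⟨ev p y, fun x hx => ev_eq_of_inner_grad_eq_zero (M.elem_isOpen T)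
    (Set.inter_univ _).symm convex_univ
    (M.elem_simplyConnected T).isPathConnected.isConnected.isPreconnected
    (fun x hx z _ => by rw [hp x hx, inner_zero_left]) hx hy⟩

theorem vrotF_eq_zero_of_face {F : M.Face} {p : Poly3} (hp : ∀ x ∈ M.face F, ev p x = 0) :
    ∀ x ∈ M.face F, vrotF (M.normal F) p x = 0 := fun x hx => by
  obtain ⟨U, hU, h⟩ := M.face_isOpen F
  rw [vrotF_eq]
  refine cross_eq_zero_of_inner_eq_zero fun v hv => ?_
  have := inner_grad_eq_zero hU h (convex_plane _ _) hp hx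
    (mem_plane_of_inner_sub (x := x + v) (M.face_subset_plane F hx) (by simpa using hv))
  rwa [add_sub_cancel_left] at this

theorem ev_eq_of_vrotF_eq_zero {F : M.Face} {p : Poly3}
    (hp : ∀ x ∈ M.face F, vrotF (M.normal F) p x = 0) : ∃ c, ∀ x ∈ M.face F, ev p x = c := by
  obtain ⟨U, hU, h⟩ := M.face_isOpen F
  obtain ⟨y, hy⟩ := (M.face_simplyConnected F).nonempty
  refine ⟨ev p y, fun x hx => ev_eq_of_inner_grad_eq_zero hU h (convex_plane _ _)
    (M.face_simplyConnected F).isPathConnected.isConnected.isPreconnected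
    (fun x hx z hz => ?_) hx hy⟩
  have h0 := hp x hx
  rw [vrotF_eq] at h0
  exact inner_eq_zero_of_cross_eq_zero (M.norm_normal F) h0
    (inner_sub_of_mem_plane hz (M.face_subset_plane F hx))

/-! ### Projections -/

theorem golyT_mem_vecPoly {X : Set E3} {k : ℕ} (w : polyLE (k + 1)) :
    (vevL X ∘ₗ gradL ∘ₗ (polyLE (k + 1)).subtype) w ∈
      LinearMap.range (vevL X ∘ₗ (vecPolyLE k).subtype) :=
  ⟨⟨grad w.1, grad_mem_vecPolyLE w.2⟩, rfl⟩

theorem range_vevL_le (T : M.Elem) (k : ℕ) :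
    LinearMap.range (vevL (M.elem T) ∘ₗ (vecPolyLE k).subtype) ≤ bddCont (M.elem T) E3 := by
  rintro _ ⟨w, rfl⟩
  exact vevL_mem_bddCont (M.elem_isBounded T) _

theorem mem_golyPerpT_iff {k : ℕ} {v : M.elem T → E3} :
    v ∈ golyPerpT (M.elem T) k ↔ v ∈ perpRange μHE[3] _ (range_vevL_le T k)
      (vevL (M.elem T) ∘ₗ gradL ∘ₗ (polyLE (k + 1)).subtype) golyT_mem_vecPoly := by
  refine and_congr mem_vecPolyOn_iff ⟨fun h w => h _ (mem_golyT_iff.2 ⟨w, rfl⟩), fun h w hw => ?_⟩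
  obtain ⟨p, rfl⟩ := mem_golyT_iff.1 hw
  exact h p

theorem existsUnique_proj_golyT {ℓ : ℤ} {v : M.elem T → E3} (hv : v ∈ bddCont (M.elem T) E3) :
    ∃! g, IsProj (golyT (M.elem T) ℓ) v g := by
  have hb : ∀ w, (vevL (M.elem T) ∘ₗ gradL ∘ₗ (polyLE (ℓ + 1)).subtype) w ∈
      bddCont (M.elem T) E3 := fun w => vevL_mem_bddCont (M.elem_isBounded T) _
  refine (existsUnique_congr fun g => ?_).1 (existsUnique_riesz (μHE[3] : Measure (M.elem T)) _ hb
    (pairing μHE[3] hv _ hb) fun w hw => by simp only [pairing_apply, hw]; simp)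
  refine and_congr mem_golyT_iff.symm ⟨fun h w hw => ?_, fun h w => h _ (mem_golyT_iff.2 ⟨w, rfl⟩)⟩
  obtain ⟨p, rfl⟩ := mem_golyT_iff.1 hw
  exact h p

theorem existsUnique_proj_golyPerpT {k : ℕ} {v : M.elem T → E3}
    (hv : v ∈ bddCont (M.elem T) E3) : ∃! g, IsProj (golyPerpT (M.elem T) k) v g := by
  set P := perpRange μHE[3] _ (range_vevL_le T k)
      (vevL (M.elem T) ∘ₗ gradL ∘ₗ (polyLE (k + 1)).subtype) golyT_mem_vecPoly with hP
  have : Module.Finite ℝ P :=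
    Submodule.finiteDimensional_of_le (S₂ := LinearMap.range (vevL (M.elem T) ∘ₗ
      (vecPolyLE k).subtype)) fun v hv => hv.1
  have hb : ∀ w, P.subtype w ∈ bddCont (M.elem T) E3 := fun w => range_vevL_le T k w.2.1
  refine (existsUnique_congr fun g => ?_).1 (existsUnique_riesz (μHE[3] : Measure (M.elem T))
    P.subtype hb (pairing μHE[3] hv _ hb) fun w hw => by simp only [pairing_apply, hw]; simp)
  rw [Submodule.range_subtype]
  exact and_congr mem_golyPerpT_iff.symm
    ⟨fun h w hw => h ⟨w, mem_golyPerpT_iff.1 hw⟩, fun h w => h _ (mem_golyPerpT_iff.2 w.2)⟩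

/-! ### The face operators -/

section Face

variable {k : ℕ} {F : M.FaceOf T} {υ : M.CurlVecF F.1}

/-- Solvability requires the right-hand side to depend only on the restriction of the test
polynomial to $F$: its rotor involves tangential derivatives only, and the edges lie in the closure
of $F$. -/
theorem existsUnique_faceCurl (hR : υ.vR ∈ bddCont (M.face F.1) E3)
    (hE : ∀ E, υ.vE E ∈ bddCont (M.edge E.1) ℝ) : ∃! c, M.IsFaceCurl k F.1 υ c := by
  have hb : ∀ w, (evL (M.face F.1) ∘ₗ (polyLE k).subtype) w ∈ bddCont (M.face F.1) ℝ :=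
    fun w => evL_mem_bddCont (face_isBounded F) _
  have hbR : ∀ w, (vrotL (M.normal F.1) (M.face F.1) ∘ₗ (polyLE k).subtype) w ∈
      bddCont (M.face F.1) E3 := fun w => vrotL_mem_bddCont (face_isBounded F) _ _
  have hbE : ∀ (E : M.EdgeOf F.1) w, (evL (M.edge E.1) ∘ₗ (polyLE k).subtype) w ∈
      bddCont (M.edge E.1) ℝ := fun E w => evL_mem_bddCont (edge_isBounded E.1) _
  let L : polyLE k →ₗ[ℝ] ℝ := pairing μHE[2] hR _ hbR -
    ∑ E : M.EdgeOf F.1, M.omegaFE F.1 E.1 • pairing μHE[1] (hE E) _ (hbE E)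
  have hL : ∀ w : polyLE k, L w = ip 2 υ.vR (fun x : M.face F.1 => vrotF (M.normal F.1) w x)
      - ∑ E : M.EdgeOf F.1, M.omegaFE F.1 E.1 *
        ∫ x : M.edge E.1, υ.vE E x * ev w x ∂μHE[1] := fun w => by
    simp only [L, LinearMap.sub_apply, LinearMap.sum_apply, LinearMap.smul_apply, pairing_apply,
      smul_eq_mul, real_inner_eq_mul, LinearMap.comp_apply, vrotL_apply]
    rfl
  refine (existsUnique_congr fun c => ?_).1 (existsUnique_riesz (μHE[2] : Measure (M.face F.1)) _ hb
    L fun w hw => ?_)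
  · refine and_congr mem_polyOn_iff.symm ⟨fun h q hq => ?_, fun h w => ?_⟩
    · rw [← hL ⟨q, hq⟩, ← h]
      simp only [real_inner_eq_mul]
      rfl
    · rw [hL, ← h w.1 w.2]
      simp only [real_inner_eq_mul]
      rfl
  · have h0 : ∀ x ∈ M.face F.1, ev w x = 0 := fun x hx => congrFun hw ⟨x, hx⟩
    have h1 : (fun x : M.face F.1 => vrotF (M.normal F.1) w x) = 0 :=
      funext fun x => vrotF_eq_zero_of_face h0 x x.2
    have h2 : ∀ (E : M.EdgeOf F.1) (x : M.edge E.1), ev w x = 0 := fun E x =>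
      eq_zero_of_subset_closure (fun y hy => (E.2 hy).1) h0 x x.2
    rw [hL, h1]
    simp [h2, ip]

theorem isFaceCurl_faceCurl (hR : υ.vR ∈ bddCont (M.face F.1) E3)
    (hE : ∀ E, υ.vE E ∈ bddCont (M.edge E.1) ℝ) : M.IsFaceCurl k F.1 υ (M.faceCurl k F.1 υ) :=
  Classical.epsilon_spec (existsUnique_faceCurl hR hE).exists

/-- The right-hand side of the problem defining the face potential, on the rotors. -/
def facePotentialRHS (k : ℕ) (F : M.Face) (υ : M.CurlVecF F) (r : Poly3) : ℝ :=
  (∫ x : M.face F, M.faceCurl k F υ x * ev r x ∂μHE[2])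
    + ∑ E : M.EdgeOf F, M.omegaFE F E.1 * ∫ x : M.edge E.1, υ.vE E x * ev r x ∂μHE[1]

/-- This is the problem defining $C_F$ tested with a constant, whose rotor is zero. -/
theorem facePotentialRHS_C (hR : υ.vR ∈ bddCont (M.face F.1) E3)
    (hE : ∀ E, υ.vE E ∈ bddCont (M.edge E.1) ℝ) (c : ℝ) :
    facePotentialRHS k F.1 υ (MvPolynomial.C c) = 0 := by
  have h := (isFaceCurl_faceCurl (k := k) hR hE).2 (MvPolynomial.C c) (C_mem_polyLE c k)
  have h0 : ip 2 υ.vR (fun x : M.face F.1 => vrotF (M.normal F.1) (MvPolynomial.C c) x) = 0 := by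
    simp only [vrotF_eq, grad_C, vev_zero, ← crossL_apply, map_zero]
    simp [ip]
  rw [facePotentialRHS, h, h0]
  ring

theorem exists_facePotentialRHS_eq (hR : υ.vR ∈ bddCont (M.face F.1) E3)
    (hE : ∀ E, υ.vE E ∈ bddCont (M.edge E.1) ℝ) :
    ∃ L : Poly3 →ₗ[ℝ] ℝ, ∀ r, L r = facePotentialRHS k F.1 υ r := by
  have hc := mem_bddCont_of_mem_polyOn (face_isBounded F) (isFaceCurl_faceCurl (k := k) hR hE).1
  refine ⟨pairing μHE[2] hc (evL (M.face F.1)) (fun w => evL_mem_bddCont (face_isBounded F) _) +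
    ∑ E : M.EdgeOf F.1, M.omegaFE F.1 E.1 • pairing μHE[1] (hE E) (evL (M.edge E.1))
      (fun w => evL_mem_bddCont (edge_isBounded E.1) _), fun r => ?_⟩
  simp only [LinearMap.add_apply, LinearMap.sum_apply, LinearMap.smul_apply, pairing_apply,
      smul_eq_mul, real_inner_eq_mul]
  rfl

theorem facePotentialRHS_eq_zero {r : Poly3} (hr : ∀ x ∈ M.face F.1, ev r x = 0) :
    facePotentialRHS k F.1 υ r = 0 := by
  have h1 : ∀ x : M.face F.1, ev r x = 0 := fun x => hr x x.2
  have h2 : ∀ (E : M.EdgeOf F.1) (x : M.edge E.1), ev r x = 0 := fun E x =>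
    eq_zero_of_subset_closure (fun y hy => (E.2 hy).1) hr x x.2
  simp [facePotentialRHS, h1, h2]

theorem tanPoly_le (F : M.FaceOf T) (k : ℕ) :
    tanPoly (M.normal F.1) (M.face F.1) k ≤ bddCont (M.face F.1) E3 := fun _ hv =>
  mem_bddCont_of_mem_vecPolyOn (face_isBounded F) hv.1

theorem mem_rolyPerpF_iff {v : M.face F.1 → E3} :
    v ∈ rolyPerpF (M.normal F.1) (M.face F.1) k ↔ v ∈ perpRange μHE[2] _ (tanPoly_le F k)
      (vrotL (M.normal F.1) (M.face F.1) ∘ₗ (polyLE (k + 1)).subtype)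
      (fun w => vrotL_mem_tanPoly w.2) := by
  refine and_congr Iff.rfl ⟨fun h w => h _ (mem_rolyF_iff.2 ⟨w, rfl⟩), fun h w hw => ?_⟩
  obtain ⟨p, rfl⟩ := mem_rolyF_iff.1 hw
  exact h p

theorem vrotF_sub_C (n : E3) (r : Poly3) (c : ℝ) (x : E3) :
    vrotF n (r - MvPolynomial.C c) x = vrotF n r x := by
  have h : grad (r - MvPolynomial.C c) = grad r := by
    rw [show grad (r - MvPolynomial.C c) = gradL (r - MvPolynomial.C c) from rfl, map_sub,
      show gradL (MvPolynomial.C c) = 0 from grad_C c, sub_zero]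
    rfl
  rw [vrotF_eq, vrotF_eq, h]

/-- The zero-average condition on the test functions of the face potential can be dropped. -/
theorem isFacePotential_iff (hR : υ.vR ∈ bddCont (M.face F.1) E3)
    (hE : ∀ E, υ.vE E ∈ bddCont (M.edge E.1) ℝ) {γ : M.face F.1 → E3} :
    M.IsFacePotential k F.1 υ γ ↔ γ ∈ tanPolyOn (M.normal F.1) (M.face F.1) k ∧
      ∀ r ∈ polyLE (k + 1), ∀ τ ∈ rolyPerpF (M.normal F.1) (M.face F.1) k,
        ip 2 γ (fun x : M.face F.1 => vrotF (M.normal F.1) r x + τ x) =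
          facePotentialRHS k F.1 υ r + ip 2 υ.vRperp τ := by
  refine and_congr_right fun _ => forall_zeroAverage_iff (face_isBounded F)
    (M.face_simplyConnected F.1).nonempty fun r c _ h τ hτ => ?_
  obtain ⟨L, hL⟩ := exists_facePotentialRHS_eq (k := k) hR hE
  have h1 := h τ hτ
  simp only [vrotF_sub_C] at h1
  rw [h1]
  have h2 : facePotentialRHS k F.1 υ (r - MvPolynomial.C c) = facePotentialRHS k F.1 υ r := by
    rw [← hL, map_sub, hL, hL, facePotentialRHS_C hR hE, sub_zero]
  exact congrArg (· + _) h2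

/-- The test fields decompose orthogonally into rotors and $\mathcal R^k(F)^\perp$. A test
polynomial with zero rotor is constant on $F$, and the right-hand side ignores both what vanishes on
$F$ and constants. -/
theorem existsUnique_facePotential (hR : υ.vR ∈ bddCont (M.face F.1) E3)
    (hRp : υ.vRperp ∈ bddCont (M.face F.1) E3)
    (hE : ∀ E, υ.vE E ∈ bddCont (M.edge E.1) ℝ) : ∃! γ, M.IsFacePotential k F.1 υ γ := by
  obtain ⟨L, hL⟩ := exists_facePotentialRHS_eq (k := k) hR hE
  refine (existsUnique_congr fun γ => ?_).1 (existsUnique_of_range_add_perpRange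
    (μHE[2] : Measure (M.face F.1)) _ (tanPoly_le F k)
    (vrotL (M.normal F.1) (M.face F.1) ∘ₗ (polyLE (k + 1)).subtype)
    (fun w => vrotL_mem_tanPoly w.2) (L ∘ₗ (polyLE (k + 1)).subtype) (fun w hw => ?_) hRp)
  · rw [isFacePotential_iff hR hE]
    refine and_congr Iff.rfl ⟨fun h r hr τ hτ => ?_, fun h w v hv => ?_⟩
    · have := h ⟨r, hr⟩ τ (mem_rolyPerpF_iff.1 hτ)
      simp only [LinearMap.comp_apply, Submodule.subtype_apply, hL, vrotL_apply] at this
      exact this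
    · have := h w.1 w.2 v (mem_rolyPerpF_iff.2 hv)
      simp only [LinearMap.comp_apply, Submodule.subtype_apply, hL, vrotL_apply]
      exact this
  · obtain ⟨c, hc⟩ := ev_eq_of_vrotF_eq_zero (F := F.1) (p := w.1) fun x hx => by
      rw [← vrotL_apply (M.normal F.1) (M.face F.1) w.1 ⟨x, hx⟩]
      exact congrFun hw ⟨x, hx⟩
    have h1 : L (w.1 - MvPolynomial.C c) = 0 := by
      rw [hL]
      exact facePotentialRHS_eq_zero fun x hx => by rw [ev_sub, ev_C, hc x hx, sub_self]
    rwa [map_sub, hL (MvPolynomial.C c), facePotentialRHS_C hR hE, sub_zero] at h1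

theorem isFacePotential_facePotential (hR : υ.vR ∈ bddCont (M.face F.1) E3)
    (hRp : υ.vRperp ∈ bddCont (M.face F.1) E3)
    (hE : ∀ E, υ.vE E ∈ bddCont (M.edge E.1) ℝ) :
    M.IsFacePotential k F.1 υ (M.facePotential k F.1 υ) :=
  Classical.epsilon_spec (existsUnique_facePotential hR hRp hE).exists

end Face

/-! ### The element operators -/

section Elem

variable {k : ℕ}

/-- A polynomial vector vanishing on the open set $T$ has zero derivatives there, hence zero curl,
and by continuity it vanishes on the faces; so the right-hand side is determined by the restriction
to $T$. -/
theorem existsUnique_elemCurl {ζ : M.CurlVec T} (hR : ζ.vR ∈ bddCont (M.elem T) E3)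
    (hγ : ∀ F : M.FaceOf T, M.facePotential k F.1 (ζ.toFace F) ∈ bddCont (M.face F.1) E3) :
    ∃! c, M.IsElemCurl k T ζ c := by
  have hb : ∀ w, (vevL (M.elem T) ∘ₗ (vecPolyLE k).subtype) w ∈ bddCont (M.elem T) E3 :=
    fun w => vevL_mem_bddCont (M.elem_isBounded T) _
  have hbR : ∀ w, (vevL (M.elem T) ∘ₗ curlL ∘ₗ (vecPolyLE k).subtype) w ∈
      bddCont (M.elem T) E3 := fun w => vevL_mem_bddCont (M.elem_isBounded T) _
  have hbF : ∀ (F : M.FaceOf T) w, (LinearMap.compLeft (crossL.flip (M.normal F.1)) (M.face F.1) ∘ₗ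
      vevL (M.face F.1) ∘ₗ (vecPolyLE k).subtype) w ∈ bddCont (M.face F.1) E3 := fun F w =>
    comp_val_mem_bddCont (face_isBounded F)
      ((continuous_cross_left (M.normal F.1)).comp (continuous_vev w.1))
  let L : vecPolyLE k →ₗ[ℝ] ℝ := pairing μHE[3] hR _ hbR +
    ∑ F : M.FaceOf T, M.omegaTF T F.1 • pairing μHE[2] (hγ F) _ (hbF F)
  have hL : ∀ w : vecPolyLE k, L w = ip 3 ζ.vR (fun x : M.elem T => vev (curl w.1) x)
      + ∑ F : M.FaceOf T, M.omegaTF T F.1 *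
          ip 2 (M.facePotential k F.1 (ζ.toFace F))
            (fun x : M.face F.1 => cross (vev w.1 x) (M.normal F.1)) := fun w => by
    simp only [L, LinearMap.add_apply, LinearMap.sum_apply, LinearMap.smul_apply, pairing_apply,
      smul_eq_mul]
    rfl
  refine (existsUnique_congr fun c => ?_).1 (existsUnique_riesz (μHE[3] : Measure (M.elem T)) _ hb
    L fun w hw => ?_)
  · refine and_congr mem_vecPolyOn_iff.symm ⟨fun h q hq => ?_, fun h w => ?_⟩
    · exact (h ⟨q, hq⟩).trans (hL ⟨q, hq⟩)
    · exact (h w.1 w.2).trans (hL w).symm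
  · have h0 : ∀ i, ∀ x ∈ M.elem T, ev (w.1 i) x = 0 := fun i x hx =>
      congrArg (fun v : E3 => v i) (congrFun hw ⟨x, hx⟩)
    have h1 : ∀ i j, ∀ x ∈ M.elem T, ev (MvPolynomial.pderiv j (w.1 i)) x = 0 := fun i j x hx =>
      congrArg (fun v : E3 => v j) (vev_grad_eq_zero_of_elem (h0 i) x hx)
    have h2 : (fun x : M.elem T => vev (curl w.1) x) = 0 := by
      funext x
      ext i
      fin_cases i <;> simp [vev, curl, ev_sub, h1 _ _ x x.2]
    have h3 : ∀ (F : M.FaceOf T) (x : M.face F.1), cross (vev w.1 x) (M.normal F.1) = 0 := by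
      intro F x
      have : vev w.1 x = 0 := by
        ext i
        exact eq_zero_of_subset_closure (F.2.trans frontier_subset_closure) (h0 i) x x.2
      rw [this, ← crossL_apply, map_zero]
      rfl
    rw [hL, h2]
    simp [h3, ip]

theorem existsUnique_discreteDiv {w : M.DivVec T} (hG : w.wG ∈ bddCont (M.elem T) E3)
    (hF : ∀ F : M.FaceOf T, w.wF F ∈ bddCont (M.face F.1) ℝ) :
    ∃! d, M.IsDiscreteDiv k T w d := by
  have hb : ∀ q, (evL (M.elem T) ∘ₗ (polyLE k).subtype) q ∈ bddCont (M.elem T) ℝ :=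
    fun q => evL_mem_bddCont (M.elem_isBounded T) _
  have hbG : ∀ q, (vevL (M.elem T) ∘ₗ gradL ∘ₗ (polyLE k).subtype) q ∈
      bddCont (M.elem T) E3 := fun q => vevL_mem_bddCont (M.elem_isBounded T) _
  have hbF : ∀ (F : M.FaceOf T) q, (evL (M.face F.1) ∘ₗ (polyLE k).subtype) q ∈
      bddCont (M.face F.1) ℝ := fun F q => evL_mem_bddCont (face_isBounded F) _
  let L : polyLE k →ₗ[ℝ] ℝ := - pairing μHE[3] hG _ hbG +
    ∑ F : M.FaceOf T, M.omegaTF T F.1 • pairing μHE[2] (hF F) _ (hbF F)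
  have hL : ∀ q : polyLE k, L q = - ip 3 w.wG (fun x : M.elem T => vev (grad q) x)
      + ∑ F : M.FaceOf T, M.omegaTF T F.1 *
        ∫ x : M.face F.1, w.wF F x * ev q x ∂μHE[2] := fun q => by
    simp only [L, LinearMap.add_apply, LinearMap.neg_apply, LinearMap.sum_apply,
      LinearMap.smul_apply, pairing_apply, smul_eq_mul, real_inner_eq_mul]
    rfl
  refine (existsUnique_congr fun c => ?_).1 (existsUnique_riesz (μHE[3] : Measure (M.elem T)) _ hb
    L fun q hq => ?_)
  · refine and_congr mem_polyOn_iff.symm ⟨fun h q hq => ?_, fun h q => ?_⟩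
    · rw [← hL ⟨q, hq⟩, ← h]
      simp only [real_inner_eq_mul]
      rfl
    · rw [hL, ← h q.1 q.2]
      simp only [real_inner_eq_mul]
      rfl
  · have h0 : ∀ x ∈ M.elem T, ev q x = 0 := fun x hx => congrFun hq ⟨x, hx⟩
    have h1 : (fun x : M.elem T => vev (grad q) x) = 0 :=
      funext fun x => vev_grad_eq_zero_of_elem h0 x x.2
    have h2 : ∀ (F : M.FaceOf T) (x : M.face F.1), ev q x = 0 := fun F x =>
      eq_zero_of_subset_closure (F.2.trans frontier_subset_closure) h0 x x.2
    rw [hL, h1]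
    simp [h2, ip]

theorem isDiscreteDiv_discreteDiv {w : M.DivVec T} (hG : w.wG ∈ bddCont (M.elem T) E3)
    (hF : ∀ F : M.FaceOf T, w.wF F ∈ bddCont (M.face F.1) ℝ) :
    M.IsDiscreteDiv k T w (M.discreteDiv k T w) :=
  Classical.epsilon_spec (existsUnique_discreteDiv hG hF).exists

/-- The right-hand side of the problem defining the vector potential, on the gradients. -/
def divPotentialRHS (k : ℕ) (T : M.Elem) (w : M.DivVec T) (q : Poly3) : ℝ :=
  - (∫ x : M.elem T, M.discreteDiv k T w x * ev q x ∂μHE[3])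
    + ∑ F : M.FaceOf T, M.omegaTF T F.1 * ∫ x : M.face F.1, w.wF F x * ev q x ∂μHE[2]

/-- This is the problem defining $D_T$ tested with a constant, whose gradient is zero. -/
theorem divPotentialRHS_C {w : M.DivVec T} (hG : w.wG ∈ bddCont (M.elem T) E3)
    (hF : ∀ F : M.FaceOf T, w.wF F ∈ bddCont (M.face F.1) ℝ) (c : ℝ) :
    divPotentialRHS k T w (MvPolynomial.C c) = 0 := by
  have h := (isDiscreteDiv_discreteDiv (k := k) hG hF).2 (MvPolynomial.C c) (C_mem_polyLE c k)
  have h0 : ip 3 w.wG (fun x : M.elem T => vev (grad (MvPolynomial.C c)) x) = 0 := by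
    simp [grad_C, vev_zero, ip]
  rw [divPotentialRHS, h, h0]
  ring

theorem exists_divPotentialRHS_eq {w : M.DivVec T} (hG : w.wG ∈ bddCont (M.elem T) E3)
    (hF : ∀ F : M.FaceOf T, w.wF F ∈ bddCont (M.face F.1) ℝ) :
    ∃ L : Poly3 →ₗ[ℝ] ℝ, ∀ q, L q = divPotentialRHS k T w q := by
  have hd := mem_bddCont_of_mem_polyOn (M.elem_isBounded T)
    (isDiscreteDiv_discreteDiv (k := k) hG hF).1
  refine ⟨- pairing μHE[3] hd (evL (M.elem T)) (fun w => evL_mem_bddCont (M.elem_isBounded T) _) +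
    ∑ F : M.FaceOf T, M.omegaTF T F.1 • pairing μHE[2] (hF F) (evL (M.face F.1))
      (fun w => evL_mem_bddCont (face_isBounded F) _), fun r => ?_⟩
  simp only [LinearMap.add_apply, LinearMap.neg_apply, LinearMap.sum_apply, LinearMap.smul_apply,
    pairing_apply, smul_eq_mul, real_inner_eq_mul]
  rfl

theorem divPotentialRHS_eq_zero {w : M.DivVec T} {q : Poly3} (hq : ∀ x ∈ M.elem T, ev q x = 0) :
    divPotentialRHS k T w q = 0 := by
  have h1 : ∀ x : M.elem T, ev q x = 0 := fun x => hq x x.2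
  have h2 : ∀ (F : M.FaceOf T) (x : M.face F.1), ev q x = 0 := fun F x =>
    eq_zero_of_subset_closure (F.2.trans frontier_subset_closure) hq x x.2
  simp [divPotentialRHS, h1, h2]

/-- The zero-average condition on the test functions of the vector potential can be dropped. -/
theorem isDivPotential_iff {w : M.DivVec T} (hG : w.wG ∈ bddCont (M.elem T) E3)
    (hF : ∀ F : M.FaceOf T, w.wF F ∈ bddCont (M.face F.1) ℝ) {P : M.elem T → E3} :
    M.IsDivPotential k T w P ↔ P ∈ vecPolyOn (M.elem T) k ∧
      ∀ q ∈ polyLE (k + 1), ∀ v ∈ golyPerpT (M.elem T) k,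
        ip 3 P (fun x : M.elem T => vev (grad q) x + v x) =
          divPotentialRHS k T w q + ip 3 w.wGperp v := by
  refine and_congr_right fun _ => forall_zeroAverage_iff (M.elem_isBounded T)
    (M.elem_simplyConnected T).nonempty fun q c _ h v hv => ?_
  obtain ⟨L, hL⟩ := exists_divPotentialRHS_eq (k := k) hG hF
  have h1 := h v hv
  have h3 : grad (q - MvPolynomial.C c) = grad q := by
    rw [show grad (q - MvPolynomial.C c) = gradL (q - MvPolynomial.C c) from rfl, map_sub,
      show gradL (MvPolynomial.C c) = 0 from grad_C c, sub_zero]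
    rfl
  rw [h3] at h1
  rw [h1]
  have h2 : divPotentialRHS k T w (q - MvPolynomial.C c) = divPotentialRHS k T w q := by
    rw [← hL, map_sub, hL, hL, divPotentialRHS_C hG hF, sub_zero]
  exact congrArg (· + _) h2

/-- Orthogonal decomposition into gradients and $\mathcal G^k(T)^\perp$; a polynomial with zero
gradient on the connected $T$ is constant there, and constants are annihilated by the right-hand
side. -/
theorem existsUnique_divPotential {w : M.DivVec T} (hG : w.wG ∈ bddCont (M.elem T) E3)
    (hGp : w.wGperp ∈ bddCont (M.elem T) E3)
    (hF : ∀ F : M.FaceOf T, w.wF F ∈ bddCont (M.face F.1) ℝ) :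
    ∃! P, M.IsDivPotential k T w P := by
  obtain ⟨L, hL⟩ := exists_divPotentialRHS_eq (k := k) hG hF
  refine (existsUnique_congr fun P => ?_).1 (existsUnique_of_range_add_perpRange
    (μHE[3] : Measure (M.elem T)) _ (range_vevL_le T k)
    (vevL (M.elem T) ∘ₗ gradL ∘ₗ (polyLE (k + 1)).subtype)
    golyT_mem_vecPoly (L ∘ₗ (polyLE (k + 1)).subtype) (fun q hq => ?_) hGp)
  · rw [isDivPotential_iff hG hF]
    refine and_congr mem_vecPolyOn_iff.symm ⟨fun h q hq v hv => ?_, fun h q v hv => ?_⟩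
    · rw [← hL]
      exact h ⟨q, hq⟩ v (mem_golyPerpT_iff.1 hv)
    · have := h q.1 q.2 v (mem_golyPerpT_iff.2 hv)
      rw [← hL] at this
      exact this
  · obtain ⟨c, hc⟩ := ev_eq_of_vev_grad_eq_zero (T := T) (p := q.1) fun x hx =>
      congrFun hq ⟨x, hx⟩
    have h1 : L (q.1 - MvPolynomial.C c) = 0 := by
      rw [hL]
      exact divPotentialRHS_eq_zero fun x hx => by rw [ev_sub, ev_C, hc x hx, sub_self]
    rwa [map_sub, hL (MvPolynomial.C c), divPotentialRHS_C hG hF, sub_zero] at h1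

end Elem

end PolyMesh

end

end DDR

namespace DDR

noncomputable section

namespace PolyMesh

variable {Ω : Set E3} {M : PolyMesh Ω} {T : M.Elem} {k : ℕ}

/-! ### The link between the vector potential and the full element curl -/

theorem toFace_mem_bddCont {ζ : M.CurlVec T} (hζ : ζ ∈ M.Xcurl k T) (F : M.FaceOf T) :
    (ζ.toFace F).vR ∈ bddCont (M.face F.1) E3 ∧ (ζ.toFace F).vRperp ∈ bddCont (M.face F.1) E3 ∧
      ∀ E, (ζ.toFace F).vE E ∈ bddCont (M.edge E.1) ℝ :=
  ⟨mem_bddCont_of_mem_rolyF (face_isBounded F) (hζ.2.2.1 F).1,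
    mem_bddCont_of_mem_vecPolyOn (face_isBounded F) (hζ.2.2.1 F).2.1.1,
    fun E => mem_bddCont_of_mem_polyOn (edge_isBounded E.1) (hζ.2.2.2 ⟨E.1, F, E.2⟩)⟩

theorem isFacePotential_toFace {ζ : M.CurlVec T} (hζ : ζ ∈ M.Xcurl k T) (F : M.FaceOf T) :
    M.IsFacePotential k F.1 (ζ.toFace F) (M.facePotential k F.1 (ζ.toFace F)) :=
  have h := toFace_mem_bddCont hζ F
  isFacePotential_facePotential h.1 h.2.1 h.2.2

theorem isFaceCurl_toFace {ζ : M.CurlVec T} (hζ : ζ ∈ M.Xcurl k T) (F : M.FaceOf T) :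
    M.IsFaceCurl k F.1 (ζ.toFace F) (M.faceCurl k F.1 (ζ.toFace F)) :=
  have h := toFace_mem_bddCont hζ F
  isFaceCurl_faceCurl h.1 h.2.2

theorem existsUnique_elemCurl_of_mem {ζ : M.CurlVec T} (hζ : ζ ∈ M.Xcurl k T) :
    ∃! c, M.IsElemCurl k T ζ c :=
  existsUnique_elemCurl (mem_bddCont_of_mem_rolyT (M.elem_isBounded T) hζ.1) fun F =>
    mem_bddCont_of_mem_vecPolyOn (face_isBounded F) (isFacePotential_toFace hζ F).1.1

theorem isElemCurl_elemCurl {ζ : M.CurlVec T} (hζ : ζ ∈ M.Xcurl k T) :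
    M.IsElemCurl k T ζ (M.elemCurl k T ζ) :=
  Classical.epsilon_spec (existsUnique_elemCurl_of_mem hζ).exists

theorem elemCurl_mem_bddCont {ζ : M.CurlVec T} (hζ : ζ ∈ M.Xcurl k T) :
    M.elemCurl k T ζ ∈ bddCont (M.elem T) E3 :=
  mem_bddCont_of_mem_vecPolyOn (M.elem_isBounded T) (isElemCurl_elemCurl hζ).1

theorem isProj_discreteCurl_wG {ζ : M.CurlVec T} (hζ : ζ ∈ M.Xcurl k T) :
    IsProj (golyT (M.elem T) (k - 1)) (M.elemCurl k T ζ) (M.discreteCurl k T ζ).wG :=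
  Classical.epsilon_spec (existsUnique_proj_golyT (elemCurl_mem_bddCont hζ)).exists

theorem isProj_discreteCurl_wGperp {ζ : M.CurlVec T} (hζ : ζ ∈ M.Xcurl k T) :
    IsProj (golyPerpT (M.elem T) k) (M.elemCurl k T ζ) (M.discreteCurl k T ζ).wGperp :=
  Classical.epsilon_spec (existsUnique_proj_golyPerpT (elemCurl_mem_bddCont hζ)).exists

theorem discreteCurl_mem_Xdiv {ζ : M.CurlVec T} (hζ : ζ ∈ M.Xcurl k T) :
    M.discreteCurl k T ζ ∈ M.Xdiv k T :=
  ⟨(isProj_discreteCurl_wG hζ).1, (isProj_discreteCurl_wGperp hζ).1,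
    fun F => (isFaceCurl_toFace hζ F).1⟩

theorem mem_bddCont_of_mem_Xdiv {w : M.DivVec T} (hw : w ∈ M.Xdiv k T) :
    w.wG ∈ bddCont (M.elem T) E3 ∧ w.wGperp ∈ bddCont (M.elem T) E3 ∧
      ∀ F : M.FaceOf T, w.wF F ∈ bddCont (M.face F.1) ℝ :=
  ⟨mem_bddCont_of_mem_golyT (M.elem_isBounded T) hw.1,
    mem_bddCont_of_mem_vecPolyOn (M.elem_isBounded T) hw.2.1.1,
    fun F => mem_bddCont_of_mem_polyOn (face_isBounded F) (hw.2.2 F)⟩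

open Classical in
/-- Edge contributions of the faces of an element cancel. -/
theorem sum_omega_mul_sum_omega_eq_zero (I : M.EdgeOfElem T → ℝ) :
    ∑ F : M.FaceOf T, M.omegaTF T F.1 *
      ∑ E : M.EdgeOf F.1, M.omegaFE F.1 E.1 * I ⟨E.1, F, E.2⟩ = 0 := by
  have := Fintype.ofFinite M.Edge
  -- Extension by zero to all edges of the mesh, so that the inner sum has a fixed index set and the
  -- two sums can be exchanged.
  let J : M.Edge → ℝ := fun E =>
    if h : ∃ F : M.FaceOf T, M.edge E ⊆ closure (M.face F.1) \ M.face F.1 then I ⟨E, h⟩ else 0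
  have hinner : ∀ F : M.FaceOf T, ∑ E : M.EdgeOf F.1, M.omegaFE F.1 E.1 * I ⟨E.1, F, E.2⟩ =
      ∑ E : M.Edge, if M.edge E ⊆ closure (M.face F.1) \ M.face F.1 then
        M.omegaFE F.1 E * J E else 0 := by
    intro F
    rw [← Finset.sum_filter, ← Finset.sum_subtype_eq_sum_filter]
    refine Finset.sum_bij' (fun E _ => (⟨E.1, E.2⟩ : {E : M.Edge //
        M.edge E ⊆ closure (M.face F.1) \ M.face F.1}))
      (fun E _ => (⟨E.1, E.2⟩ : M.EdgeOf F.1))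
      (fun _ _ => Finset.mem_subtype.2 (Finset.mem_univ _))
      (fun _ _ => Finset.mem_univ _) (fun _ _ => rfl)
      (fun _ _ => rfl) fun E _ => ?_
    have h : ∃ F : M.FaceOf T, M.edge E.1 ⊆ closure (M.face F.1) \ M.face F.1 := ⟨F, E.2⟩
    simp only [J]
    rw [dif_pos h]
  simp only [hinner, Finset.mul_sum]
  rw [Finset.sum_comm]
  refine Finset.sum_eq_zero fun E _ => ?_
  have h := sum_omega_mul_omega_eq_zero T E
  have h2 : ∑ F : M.FaceOf T, M.omegaTF T F.1 *
      (if M.edge E ⊆ closure (M.face F.1) \ M.face F.1 then M.omegaFE F.1 E * J E else 0) =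
      (∑ F : {F : M.FaceOf T // M.edge E ⊆ closure (M.face F.1) \ M.face F.1},
        M.omegaTF T F.1.1 * M.omegaFE F.1.1 E) * J E := by
    rw [Finset.sum_mul]
    simp only [mul_ite, mul_zero, ← mul_assoc]
    rw [← Finset.sum_filter]
    exact Finset.sum_subtype _ (by simp) _
  rw [h2, h, zero_mul]

theorem zero_mem_rolyPerpF (n : E3) (X : Set E3) (ℓ : ℤ) : (0 : X → E3) ∈ rolyPerpF n X ℓ :=
  ⟨(tanPoly n X ℓ).zero_mem, fun w _ => by simp [ip]⟩

/-- The full element curl tested with gradients. -/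
theorem ip_elemCurl_grad {ζ : M.CurlVec T} (hζ : ζ ∈ M.Xcurl k T) {q : Poly3}
    (hq : q ∈ polyLE (k + 1)) :
    ip 3 (M.elemCurl k T ζ) (fun x : M.elem T => vev (grad q) x) =
      ∑ F : M.FaceOf T, M.omegaTF T F.1 *
        ∫ x : M.face F.1, (M.discreteCurl k T ζ).wF F x * ev q x ∂μHE[2] := by
  rw [(isElemCurl_elemCurl hζ).2 (grad q) (grad_mem_vecPolyLE hq)]
  have h0 : ip 3 ζ.vR (fun x : M.elem T => vev (curl (grad q)) x) = 0 := by
    simp [curl_grad, vev_zero, ip]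
  have hF : ∀ F : M.FaceOf T, ip 2 (M.facePotential k F.1 (ζ.toFace F))
      (fun x : M.face F.1 => cross (vev (grad q) x) (M.normal F.1)) =
      facePotentialRHS k F.1 (ζ.toFace F) q := by
    intro F
    obtain ⟨hR, hRp, hE⟩ := toFace_mem_bddCont hζ F
    -- Test with the rotor of `q` alone, taking zero in the orthogonal complement. `q` need not have
    -- zero average on the face, which is why that restriction had to be removed.
    have h := ((isFacePotential_iff hR hE).1 (isFacePotential_toFace hζ F)).2 q hq 0
      (zero_mem_rolyPerpF _ _ _)
    simp only [vrotF_eq, Pi.zero_apply, add_zero] at h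
    rw [h]
    simp [ip]
  rw [h0, zero_add]
  simp only [hF, facePotentialRHS, mul_add, Finset.sum_add_distrib]
  have := sum_omega_mul_sum_omega_eq_zero (T := T)
    (fun E => ∫ x : M.edge E.1, ζ.vE E x * ev q x ∂μHE[1])
  exact add_eq_left.2 this

/-- The discrete divergence of a discrete curl vanishes. -/
theorem discreteDiv_discreteCurl {ζ : M.CurlVec T} (hζ : ζ ∈ M.Xcurl k T) :
    M.discreteDiv k T (M.discreteCurl k T ζ) = 0 := by
  obtain ⟨hG, -, hF⟩ := mem_bddCont_of_mem_Xdiv (discreteCurl_mem_Xdiv hζ)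
  refine (existsUnique_discreteDiv (k := k) hG hF).unique (isDiscreteDiv_discreteDiv hG hF)
    ⟨⟨0, Submodule.zero_mem _, fun x => by simp [ev]⟩, fun q hq => ?_⟩
  have h1 : ip 3 (M.discreteCurl k T ζ).wG (fun x : M.elem T => vev (grad q) x) =
      ip 3 (M.elemCurl k T ζ) (fun x : M.elem T => vev (grad q) x) :=
    -- As `q` has degree at most $k$, its gradient lies in $\mathcal G^{k-1}(T)$ and does not see
    -- the projection. The degrees are integers, so $(k-1)+1=k$ also for $k=0$.
    (isProj_discreteCurl_wG hζ).2 _ ⟨q, by rwa [sub_add_cancel], fun x => rfl⟩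
  rw [h1, ip_elemCurl_grad hζ (polyLE_mono_succ k hq), neg_add_cancel]
  simp

/-- By uniqueness it is enough that the full curl solves the problem. The gradient part is
`ip_elemCurl_grad` with zero discrete divergence; the complementary part is the defining property of
the projection on $\mathcal G^k(T)^\perp$. -/
theorem divPotential_discreteCurl {ζ : M.CurlVec T} (hζ : ζ ∈ M.Xcurl k T) :
    M.divPotential k T (M.discreteCurl k T ζ) = M.elemCurl k T ζ := by
  obtain ⟨hG, hGp, hF⟩ := mem_bddCont_of_mem_Xdiv (discreteCurl_mem_Xdiv hζ)
  have hu := existsUnique_divPotential (k := k) hG hGp hF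
  refine hu.unique (Classical.epsilon_spec hu.exists) ((isDivPotential_iff hG hF).2
    ⟨(isElemCurl_elemCurl hζ).1, fun q hq v hv => ?_⟩)
  have hv' := mem_bddCont_of_mem_vecPolyOn (M.elem_isBounded T) hv.1
  have h1 : ip 3 (M.elemCurl k T ζ) (fun x : M.elem T => vev (grad q) x + v x) =
      ip 3 (M.elemCurl k T ζ) (fun x : M.elem T => vev (grad q) x) +
      ip 3 (M.elemCurl k T ζ) v :=
    integral_inner_add_right _ (elemCurl_mem_bddCont hζ)
      (vevL_mem_bddCont (M.elem_isBounded T) (grad q)) hv'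
  rw [h1, ip_elemCurl_grad hζ hq, ← (isProj_discreteCurl_wGperp hζ).2 v hv, divPotentialRHS,
    discreteDiv_discreteCurl hζ]
  simp

end PolyMesh

end

end DDR

/-! ### The proposition -/

theorem mainTheorem8 {Ω : Set DDR.E3} (M : DDR.PolyMesh Ω) (k : ℕ) (T : M.Elem) :
    -- the operators are well defined: their defining problems have exactly one solution
    (∀ v ∈ DDR.vecPolyOn (M.elem T) k,
      (∃! g, DDR.IsProj (DDR.golyT (M.elem T) (k - 1)) v g) ∧
      (∃! g, DDR.IsProj (DDR.golyPerpT (M.elem T) k) v g)) ∧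
    (∀ ζ ∈ M.Xcurl k T,
      (∀ F : M.FaceOf T,
        (∃! c, M.IsFaceCurl k F.1 (ζ.toFace F) c) ∧
        (∃! γ, M.IsFacePotential k F.1 (ζ.toFace F) γ)) ∧
      (∃! c, M.IsElemCurl k T ζ c) ∧
      M.discreteCurl k T ζ ∈ M.Xdiv k T) ∧
    (∀ w ∈ M.Xdiv k T,
      (∃! d, M.IsDiscreteDiv k T w d) ∧ (∃! P, M.IsDivPotential k T w P)) ∧
    -- the link between the potential reconstruction and the full element curl
    (∀ ζ ∈ M.Xcurl k T,
      M.divPotential k T (M.discreteCurl k T ζ) = M.elemCurl k T ζ) := by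
  refine ⟨fun v hv => ?_, fun ζ hζ => ⟨fun F => ?_, ?_, ?_⟩, fun w hw => ?_, fun ζ hζ => ?_⟩
  · have hb := DDR.mem_bddCont_of_mem_vecPolyOn (M.elem_isBounded T) hv
    exact ⟨DDR.PolyMesh.existsUnique_proj_golyT hb, DDR.PolyMesh.existsUnique_proj_golyPerpT hb⟩
  · obtain ⟨hR, hRp, hE⟩ := DDR.PolyMesh.toFace_mem_bddCont hζ F
    exact ⟨DDR.PolyMesh.existsUnique_faceCurl hR hE,
      DDR.PolyMesh.existsUnique_facePotential hR hRp hE⟩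
  · exact DDR.PolyMesh.existsUnique_elemCurl_of_mem hζ
  · exact DDR.PolyMesh.discreteCurl_mem_Xdiv hζ
  · obtain ⟨hG, hGp, hF⟩ := DDR.PolyMesh.mem_bddCont_of_mem_Xdiv hw
    exact ⟨DDR.PolyMesh.existsUnique_discreteDiv hG hF,
      DDR.PolyMesh.existsUnique_divPotential hG hGp hF⟩
  · exact DDR.PolyMesh.divPotential_discreteCurl hζ
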